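/- A \emph{2-stratifold} is a compact, connected Hausdorff space $X$ together with a closed subspace $X_1\subset X$ that is a closed $1$-manifold, such that each point $x\in X_1$ has an open neighborhood $U$ with $(U,U\cap X_1)\cong(\mathbb{R}\times CL,\ \mathbb{R}\times\{\text{cone point}\})$, where $CL$ is the open cone on a finite set $L$ with more than two elements, and each $x\in X\setminus X_1$ has an open neighborhood homeomorphic to $\mathbb{R}^2$. Each component $C\cong S^1$ of $X_1$ has a regular neighborhood $N(C)$ with core $C$ that is the mapping cylinder of a covering $\tilde C_1\sqcup\dots\sqcup\tilde C_r\to C$ of circles, of degree $n_i\ge 1$ on $\tilde C_i$, and whose frontier in $X$ is its boundary $\tilde C_1\sqcup\dots\sqcup\tilde C_r$; choose these neighborhoods pairwise disjoint. The associated labeled bicolored graph $G$ (multiple edges are allowed) has as black vertices the neighborhoods $N(C)$, as white vertices the components of $M=\overline{X\setminus\bigcup_C N(C)}$, and as edges the boundary circles $\tilde C_i$ of the neighborhoods $N(C)$; the edge $\tilde C_i$ joins $N(C)$ to the component of $M$ that contains $\tilde C_i$ and has label $n_i$. A vertex is \emph{terminal} if it is incident to exactly one edge, and an edge is \emph{terminal}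 if one of its vertices is terminal. The graph $G$ is \emph{trivalent} if each black vertex is incident either to exactly three edges, each with label $1$, or to exactly two edges, one with label $1$ and the other with label $2$, or to exactly one edge, with label $3$. \textbf{Lemma.} Let $X$ be a $2$-stratifold whose associated graph $G$ is trivalent and has at least one edge. If all terminal edges of $G$ have label $2$, then $H_1(X;\mathbb{Z}_2)\neq 0$. -/

import Mathlib

open Topology

universe u

/-- The open cone `L × [0, ∞) / L × {0}` on a discrete set `L` with `d` points. -/
def OpenCone (d : ℕ) : Type :=
  Quot fun a b : Fin d × NNReal => a.2 = 0 ∧ b.2 = 0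

instance (d : ℕ) : TopologicalSpace (OpenCone d) :=
  inferInstanceAs (TopologicalSpace (Quot _))

/-- The cone points of the open cone (there is exactly one as soon as `0 < d`). -/
def OpenCone.apex (d : ℕ) : Set (OpenCone d) :=
  {p | ∃ i, p = Quot.mk _ (i, 0)}

/-- `(X, X₁)` is a 2-stratifold: `X` is a compact connected Hausdorff space and `X₁` is a closed
subspace that is a closed 1-manifold, `X` looks like `(ℝ × cone on d points, ℝ × cone point)` with
`d > 2` near the points of `X₁`, and like the plane near all other points. -/
structure IsTwoStratifold {X : Type*} [TopologicalSpace X] (X₁ : Set X) : Prop where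
  compact : CompactSpace X
  connected : ConnectedSpace X
  hausdorff : T2Space X
  isClosed : IsClosed X₁
  curve : ∀ x : X₁, ∃ U : Set X₁, IsOpen U ∧ x ∈ U ∧ Nonempty (U ≃ₜ ℝ)
  singular : ∀ x ∈ X₁, ∃ U : Set X, IsOpen U ∧ x ∈ U ∧ ∃ d : ℕ, 2 < d ∧
    ∃ h : U ≃ₜ ℝ × OpenCone d, ∀ u : U, (u : X) ∈ X₁ ↔ (h u).2 ∈ OpenCone.apex d
  regular : ∀ x ∉ X₁, ∃ U : Set X, IsOpen U ∧ x ∈ U ∧ Nonempty (U ≃ₜ EuclideanSpace ℝ (Fin 2))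

theorem IsTwoStratifold.finite_components {X : Type*} [TopologicalSpace X] {X₁ : Set X}
    (h : IsTwoStratifold X₁) : Finite (ConnectedComponents X₁) := by
  have := h.compact
  have : CompactSpace X₁ := isCompact_iff_compactSpace.mp h.isClosed.isCompact
  have hd : DiscreteTopology (ConnectedComponents X₁) := by
    refine discreteTopology_iff_isOpen_singleton.mpr fun c => ?_
    obtain ⟨x, rfl⟩ := ConnectedComponents.surjective_coe c
    rw [← ConnectedComponents.isQuotientMap_coe.isOpen_preimage, connectedComponents_preimage_singleton]
    refine isOpen_iff_mem_nhds.mpr fun y hy => ?_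
    obtain ⟨U, hU, hyU, ⟨f⟩⟩ := h.curve y
    have hc : IsPreconnected U := by
      have := f.symm.surjective.denseRange.preconnectedSpace f.symm.continuous
      exact isPreconnected_iff_preconnectedSpace.mpr this
    refine Filter.mem_of_superset (hU.mem_nhds hyU) ?_
    rw [connectedComponent_eq hy]
    exact hc.subset_connectedComponent hyU
  exact finite_of_compact_of_discrete

/-- The mapping cylinder of the covering `C₁ ⊔ ⋯ ⊔ Cᵣ → C` of circles whose restriction to the
`i`-th circle is the `n i`-fold covering `z ↦ z ^ n i`: the point `(i, z, 0)` of the cylinder over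
the `i`-th circle is identified with the point `z ^ n i` of the core circle `C`. -/
def CoverCylinder {r : ℕ} (n : Fin r → ℕ) : Type :=
  Quot fun a b : (Fin r × Circle × unitInterval) ⊕ Circle =>
    ∃ i z, a = Sum.inl (i, z, 0) ∧ b = Sum.inr (z ^ n i)

namespace CoverCylinder

variable {r : ℕ} {n : Fin r → ℕ}

instance : TopologicalSpace (CoverCylinder n) :=
  inferInstanceAs (TopologicalSpace (Quot _))

instance : CompactSpace (CoverCylinder n) :=
  inferInstanceAs (CompactSpace (Quot _))

/-- The point at height `t` over the point `z` of the `i`-th circle. -/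
def point (n : Fin r → ℕ) (i : Fin r) (z : Circle) (t : unitInterval) : CoverCylinder n :=
  Quot.mk _ (Sum.inl (i, z, t))

/-- The core circle. -/
def core (n : Fin r → ℕ) : Set (CoverCylinder n) :=
  Set.range fun z : Circle => Quot.mk _ (Sum.inr z)

/-- The `i`-th boundary circle. -/
def rim (n : Fin r → ℕ) (i : Fin r) : Set (CoverCylinder n) :=
  Set.range fun z : Circle => point n i z 1

end CoverCylinder

/-- A labeled bicolored multigraph: every edge joins a white vertex to a black vertex and carries a
label. -/
structure BicoloredGraph where
  White : Type u
  Black : Type u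
  Edge : Type u
  white : Edge → White
  black : Edge → Black
  label : Edge → ℕ

namespace BicoloredGraph

variable (G : BicoloredGraph.{u})

/-- Every black vertex is incident to exactly three edges, all with label 1, or to exactly two edges,
with labels 1 and 2, or to exactly one edge, with label 3. -/
def IsTrivalent : Prop :=
  ∀ b : G.Black,
    (∃ e₁ e₂ e₃, e₁ ≠ e₂ ∧ e₁ ≠ e₃ ∧ e₂ ≠ e₃ ∧ {e | G.black e = b} = {e₁, e₂, e₃} ∧
      G.label e₁ = 1 ∧ G.label e₂ = 1 ∧ G.label e₃ = 1) ∨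
    (∃ e₁ e₂, e₁ ≠ e₂ ∧ {e | G.black e = b} = {e₁, e₂} ∧ G.label e₁ = 1 ∧ G.label e₂ = 2) ∨
    (∃ e₁, {e | G.black e = b} = {e₁} ∧ G.label e₁ = 3)

/-- An edge is terminal if one of its two vertices is terminal, that is, of degree one. -/
def IsTerminal (e : G.Edge) : Prop :=
  (∃! e', G.white e' = G.white e) ∨ (∃! e', G.black e' = G.black e)

end BicoloredGraph

/-- The connected component `c` of the subspace `A`, as a subset of the ambient space. -/
def componentSet {X : Type*} [TopologicalSpace X] {A : Set X} (c : ConnectedComponents A) :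
    Set X :=
  Subtype.val '' {x : A | ConnectedComponents.mk x = c}

/-- A regular neighborhood `N(C)` of a curve `C` in `X`: an embedded mapping cylinder of a finite
covering of `C`, with core `C`, whose topological frontier in `X` is the union of its boundary
circles (in particular it is a neighborhood of `C`). The covering degrees `mult i` are the summands
of the partition `π` of `N(C)`, one for each boundary circle. -/
structure RegularNbhd {X : Type*} [TopologicalSpace X] (C : Set X) where
  r : ℕ
  mult : Fin r → ℕ
  mult_pos : ∀ i, 0 < mult i
  emb : CoverCylinder mult → X
  isEmbedding : IsEmbedding emb
  image_core : emb '' CoverCylinder.core mult = C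
  frontier_eq : frontier (Set.range emb) = ⋃ i, emb '' CoverCylinder.rim mult i

/-- Pairwise disjoint regular neighborhoods of the components of `X₁`. -/
structure RegularNbhdSystem {X : Type*} [TopologicalSpace X] (X₁ : Set X) where
  nbhd : ∀ c : ConnectedComponents X₁, RegularNbhd (componentSet c)
  disjoint : Pairwise fun c c' => Disjoint (Set.range (nbhd c).emb) (Set.range (nbhd c').emb)

namespace RegularNbhdSystem

variable {X : Type*} [TopologicalSpace X] {X₁ : Set X} (N : RegularNbhdSystem X₁)

/-- The closure `M` of the complement of the union of the regular neighborhoods. -/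
def exterior : Set X :=
  closure (⋃ c, Set.range (N.nbhd c).emb)ᶜ

/-- The boundary circle number `i` of the regular neighborhood of `c`. -/
def circle (c : ConnectedComponents X₁) (i : Fin (N.nbhd c).r) : Set X :=
  (N.nbhd c).emb '' CoverCylinder.rim (N.nbhd c).mult i

theorem circle_subset_exterior (hX : IsTwoStratifold X₁) (c : ConnectedComponents X₁)
    (i : Fin (N.nbhd c).r) : N.circle c i ⊆ N.exterior := by
  intro x hx
  have := hX.finite_components
  have := hX.hausdorff
  have hfr : x ∈ frontier (Set.range (N.nbhd c).emb) := by
    rw [(N.nbhd c).frontier_eq]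
    exact Set.mem_iUnion.mpr ⟨i, hx⟩
  have hxr : x ∈ Set.range (N.nbhd c).emb := Set.image_subset_range _ _ hx
  have hcl : IsClosed (⋃ c' : {c' // c' ≠ c}, Set.range (N.nbhd c').emb) :=
    isClosed_iUnion_of_finite fun c' =>
      (isCompact_range (N.nbhd c').isEmbedding.continuous).isClosed
  have hnot : x ∈ (⋃ c' : {c' // c' ≠ c}, Set.range (N.nbhd c').emb)ᶜ := by
    intro h
    obtain ⟨c', h'⟩ := Set.mem_iUnion.mp h
    exact Set.disjoint_left.mp (N.disjoint c'.2) h' hxr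
  rw [frontier_eq_closure_inter_closure] at hfr
  refine mem_closure_iff.mpr fun V hV hxV => ?_
  obtain ⟨y, ⟨hyV, hyn⟩, hyc⟩ :=
    mem_closure_iff.mp hfr.2 _ (hV.inter hcl.isOpen_compl) ⟨hxV, hnot⟩
  refine ⟨y, hyV, fun h => ?_⟩
  obtain ⟨c', h'⟩ := Set.mem_iUnion.mp h
  by_cases hcc : c' = c
  · subst hcc
    exact hyc h'
  · exact hyn (Set.mem_iUnion.mpr ⟨⟨c', hcc⟩, h'⟩)

/-- A point of the boundary circle number `i` of the regular neighborhood of `c`. -/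
noncomputable def basepoint (c : ConnectedComponents X₁) (i : Fin (N.nbhd c).r) : X :=
  (N.nbhd c).emb (CoverCylinder.point _ i 1 1)

theorem basepoint_mem (c : ConnectedComponents X₁) (i : Fin (N.nbhd c).r) :
    N.basepoint c i ∈ N.circle c i :=
  ⟨_, ⟨1, rfl⟩, rfl⟩

/-- The labeled bicolored graph of a 2-stratifold: the black vertices are the components `c` of `X₁`
(equivalently, their regular neighborhoods), the white vertices are the components of the exterior
`M`, and the edges are the boundary circles `S` of the regular neighborhoods. Such a circle joins
the component of `M` that contains it (it is connected, so one of its points determines this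
component) to its regular neighborhood, and its label is the corresponding covering degree. -/
noncomputable def graph {X : Type u} [TopologicalSpace X] {X₁ : Set X} (N : RegularNbhdSystem X₁)
    (hX : IsTwoStratifold X₁) : BicoloredGraph.{u} where
  White := ConnectedComponents N.exterior
  Black := ConnectedComponents X₁
  Edge := Σ c : ConnectedComponents X₁, Fin (N.nbhd c).r
  white e := ConnectedComponents.mk
    ⟨N.basepoint e.1 e.2, N.circle_subset_exterior hX e.1 e.2 (N.basepoint_mem e.1 e.2)⟩
  black e := e.1
  label e := (N.nbhd e.1).mult e.2

end RegularNbhdSystem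

/-- The singular homology group `H₁(X; ℤ/2)`. -/
noncomputable def H1ModTwo (X : Type u) [TopologicalSpace X] : ModuleCat.{u} (ZMod 2) :=
  ((AlgebraicTopology.singularHomologyFunctor (ModuleCat.{u} (ZMod 2)) 1).obj
    (ModuleCat.of (ZMod 2) (ULift.{u} (ZMod 2)))).obj (TopCat.of X)

/-! Suppose that `H₁(X; ℤ/2) = 0`. Degree-one classes modulo 2 are represented by functions `g : X →
X → ZMod 2` which near each point of the diagonal have the form `f a + f b`. As `X` is locally path
connected, the vanishing of homology gives every such `g` a single global potential `F`
(`exists_potAt_of_subsingleton_homology`). The contradiction comes from classes dual to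
one-dimensional cuts in `X`, which count crossings of the cut.

Cutting along the middle circle of one sheet of a regular neighborhood gives a potential that is
locally constant off this circle and jumps across it. Hence every edge of the graph is a bridge, and
the graph is a forest (`exists_bridge`).

Next, cut across one point of each of several core curves. Such a cut runs into a sheet of degree
`n` along `n` arcs, which can be continued through the adjacent white piece to a chosen point of it.
At this point the ends cancel modulo 2 exactly when the labels of the edges coming from the selected
curves have even sum. If this holds at all white vertices, the cut defines a cocycle; it crosses
each selected core once, so it is not a coboundary (`weight_eq_zero`). What is needed is thus a
nonzero weight on the black vertices whose label-weighted sum vanishes at each white vertex.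

A label 3 would sit on a terminal edge, so only labels 1 and 2 occur, and label 2 is invisible
modulo 2. A white vertex on an edge of label 1 lies on a second edge. In a suitable subforest of
edges of label 1, with white vertices `WC`, black vertices `C` and edges `EC`, this yields `2|WC| ≤
|EC| < |WC| + |C|`. So there are fewer equations than unknowns, and the weight exists
(`exists_balanced_weight`). -/

open Filter

/-! ### Alexander–Spanier 1-cochains modulo 2 -/

section Cochain

theorem cochain_add_self {X : Type*} (g : X → X → ZMod 2) : g + g = 0 := by
  funext a b
  exact CharTwo.add_self_eq_zero _

theorem zmod_two_add_eq_zero_iff {a b : ZMod 2} : a + b = 0 ↔ a = b := by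
  revert a b; decide

variable {X Y : Type*} [TopologicalSpace X] [TopologicalSpace Y]

/-- Near `x`, the 1-cochain `g` is the coboundary of the function `f`. -/
def PotAt (g : X → X → ZMod 2) (f : X → ZMod 2) (x : X) : Prop :=
  ∀ᶠ p in 𝓝 x ×ˢ 𝓝 x, g p.1 p.2 = f p.1 + f p.2

/-- Near `x`, the 1-cochain `g` is a coboundary (equivalently, a cocycle). -/
def CocycleAt (g : X → X → ZMod 2) (x : X) : Prop :=
  ∃ f, PotAt g f x

theorem potAt_iff {g : X → X → ZMod 2} {f : X → ZMod 2} {x : X} :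
    PotAt g f x ↔ ∃ U, IsOpen U ∧ x ∈ U ∧ ∀ a ∈ U, ∀ b ∈ U, g a b = f a + f b := by
  unfold PotAt
  rw [((nhds_basis_opens x).prod_self).eventually_iff]
  constructor
  · rintro ⟨U, ⟨hx, hU⟩, h⟩
    exact ⟨U, hU, hx, fun a ha b hb => h (x := (a, b)) ⟨ha, hb⟩⟩
  · rintro ⟨U, hU, hx, h⟩
    exact ⟨U, ⟨hx, hU⟩, fun p hp => h _ hp.1 _ hp.2⟩

theorem potAt_of_forall {g : X → X → ZMod 2} {f : X → ZMod 2} {x : X} {U : Set X} (hU : U ∈ 𝓝 x)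
    (h : ∀ a ∈ U, ∀ b ∈ U, g a b = f a + f b) : PotAt g f x :=
  mem_of_superset (prod_mem_prod hU hU) fun _ hp => h _ hp.1 _ hp.2

theorem PotAt.eventually {g : X → X → ZMod 2} {f : X → ZMod 2} {x : X} (h : PotAt g f x) :
    ∀ᶠ y in 𝓝 x, PotAt g f y := by
  obtain ⟨U, hU, hx, h⟩ := potAt_iff.mp h
  filter_upwards [hU.mem_nhds hx] with y hy
  exact potAt_iff.mpr ⟨U, hU, hy, h⟩

theorem PotAt.add {g g' : X → X → ZMod 2} {f f' : X → ZMod 2} {x : X} (h : PotAt g f x)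
    (h' : PotAt g' f' x) : PotAt (g + g') (f + f') x := by
  filter_upwards [h, h'] with p hp hp'
  simp only [Pi.add_apply, hp, hp']
  ring

theorem PotAt.comp {g : X → X → ZMod 2} {f : X → ZMod 2} {k : Y → X} {y : Y}
    (h : PotAt g f (k y)) (hk : ContinuousAt k y) :
    PotAt (fun a b => g (k a) (k b)) (f ∘ k) y :=
  (Tendsto.prodMap hk hk).eventually h

theorem potAt_zero (x : X) : PotAt (0 : X → X → ZMod 2) 0 x :=
  Eventually.of_forall fun _ => by simp

theorem potAt_zero_iff {f : X → ZMod 2} {x : X} : PotAt 0 f x ↔ ∀ᶠ a in 𝓝 x, f a = f x := by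
  rw [potAt_iff]
  constructor
  · rintro ⟨U, hU, hx, h⟩
    filter_upwards [hU.mem_nhds hx] with a ha
    exact zmod_two_add_eq_zero_iff.mp (h a ha x hx).symm
  · intro h
    obtain ⟨U, hU, ho, hx⟩ := mem_nhds_iff.mp h
    refine ⟨U, ho, hx, fun a ha b hb => ?_⟩
    have h₁ : f a = f x := hU ha
    have h₂ : f b = f x := hU hb
    exact (zmod_two_add_eq_zero_iff.mpr (h₁.trans h₂.symm)).symm

/-- Two potentials of the same cochain differ by a locally constant function. -/
theorem PotAt.eventually_add_eq {g : X → X → ZMod 2} {f f' : X → ZMod 2} {x : X}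
    (h : PotAt g f x) (h' : PotAt g f' x) : ∀ᶠ a in 𝓝 x, f a + f' a = f x + f' x := by
  have := h.add h'
  rw [cochain_add_self] at this
  exact potAt_zero_iff.mp this

theorem PotAt.of_eventually_add_eq {g : X → X → ZMod 2} {f f' : X → ZMod 2} {x : X}
    (h : PotAt g f x) (h' : ∀ᶠ a in 𝓝 x, f a + f' a = f x + f' x) : PotAt g f' x := by
  have := h.add (potAt_zero_iff (f := f + f').mpr h')
  have hf : f + f = 0 := funext fun _ => CharTwo.add_self_eq_zero _
  rwa [add_zero, ← add_assoc, hf, zero_add] at this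

theorem IsPreconnected.eq_of_eventually_eq {f : X → ZMod 2} {s : Set X} (hs : IsPreconnected s)
    (h : ∀ x ∈ s, ∀ᶠ a in 𝓝 x, f a = f x) {a b : X} (ha : a ∈ s) (hb : b ∈ s) : f a = f b :=
  hs.constant (fun x hx => ContinuousAt.continuousWithinAt
    (tendsto_nhds_of_eventually_eq (h x hx))) ha hb

theorem CocycleAt.add {g g' : X → X → ZMod 2} {x : X} (h : CocycleAt g x) (h' : CocycleAt g' x) :
    CocycleAt (g + g') x :=
  ⟨_, h.choose_spec.add h'.choose_spec⟩

theorem CocycleAt.comp {g : X → X → ZMod 2} {k : Y → X} {y : Y}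
    (h : CocycleAt g (k y)) (hk : ContinuousAt k y) : CocycleAt (fun a b => g (k a) (k b)) y :=
  ⟨_, h.choose_spec.comp hk⟩

theorem CocycleAt.eventually {g : X → X → ZMod 2} {x : X} (h : CocycleAt g x) :
    ∀ᶠ y in 𝓝 x, CocycleAt g y :=
  h.choose_spec.eventually.mono fun _ h' => ⟨_, h'⟩

/-- On a simply connected, locally path connected space every cocycle is a coboundary: the
associated double covering has a section. -/
theorem exists_potAt_of_simplyConnected [SimplyConnectedSpace X] [LocallyPathConnectedSpace X]
    {g : X → X → ZMod 2} (hg : ∀ x, CocycleAt g x) : ∃ f, ∀ x, PotAt g f x := by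
  choose φ hφ using hg
  choose U hU hx hUφ using fun x => potAt_iff.mp (hφ x)
  -- The double covering glued from the sets `U i` with transition `φ i + φ j`. Both functions have
  -- coboundary `g` on the overlap, so their sum is constant there.
  let Z : FiberBundleCore X X (ZMod 2) :=
    { baseSet := U
      isOpen_baseSet := hU
      indexAt := id
      mem_baseSet_at := hx
      coordChange := fun i j b v => v + φ i b + φ j b
      coordChange_self := fun i b _ v => by
        rw [add_assoc, CharTwo.add_self_eq_zero, add_zero]
      continuousOn_coordChange := fun i j => by
        rcases (U i ∩ U j).eq_empty_or_nonempty with h | ⟨c, hci, hcj⟩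
        · rw [h, Set.empty_prod]
          exact continuousOn_empty _
        · refine ContinuousOn.congr
            (f := fun p : X × ZMod 2 => p.2 + (φ i c + φ j c)) ?_ ?_
          · exact ((continuous_of_discreteTopology
              (f := fun v : ZMod 2 => v + (φ i c + φ j c))).comp continuous_snd).continuousOn
          · rintro ⟨b, v⟩ ⟨⟨hbi, hbj⟩, -⟩
            have h := (hUφ i b hbi c hci).symm.trans (hUφ j b hbj c hcj)
            change v + φ i b + φ j b = v + (φ i c + φ j c)
            clear hbi hbj
            generalize φ i b = a1 at *
            generalize φ j b = a2 at *
            generalize φ i c = a3 at *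
            generalize φ j c = a4 at *
            revert v a1 a2 a3 a4
            decide
      coordChange_comp := fun i j k x _ v => by
        generalize φ i x = a
        generalize φ j x = b
        generalize φ k x = c
        revert v a b c
        decide }
  have hcov : IsCoveringMap Z.proj := FiberBundle.isCoveringMap (F := ZMod 2) (E := Z.Fiber)
  obtain ⟨x₀⟩ : Nonempty X := inferInstance
  obtain ⟨s, ⟨-, hs⟩, -⟩ := hcov.existsUnique_continuousMap_lifts (ContinuousMap.id X) x₀
    (⟨x₀, (0 : ZMod 2)⟩ : Z.TotalSpace) rfl
  have hs1 : ∀ x, (s x).1 = x := fun x => congrFun hs x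
  -- The fibre coordinate over `x` refers to the chart indexed by `x` itself, and adding `φ x x`
  -- removes this dependence. In the fixed chart `x` the section reads `φ x + f`, which is therefore
  -- locally constant.
  let f : X → ZMod 2 := fun x => (show ZMod 2 from (s x).2) + φ x x
  refine ⟨f, fun x => (hφ x).of_eventually_add_eq ?_⟩
  have hc : ContinuousAt (fun y => (Z.localTriv x (s y)).2) x := by
    refine continuousAt_snd.comp (ContinuousAt.comp ?_ s.continuous.continuousAt)
    refine (Z.localTriv x).continuousAt ?_
    rw [Z.mem_localTriv_source]
    rw [hs1]
    exact hx x
  have h2 : ∀ y, (Z.localTriv x (s y)).2 = φ x y + f y := by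
    intro y
    rw [Z.localTriv_apply]
    change (show ZMod 2 from (s y).2) + φ (s y).1 (s y).1 + φ x (s y).1 = _
    rw [hs1, add_comm]
  simp only [h2] at hc
  have := hc.eventually (IsOpen.mem_nhds (isOpen_discrete {φ x x + f x}) rfl)
  exact this

end Cochain

/-! ### Singular homology and cocycles -/

section SingularHomology

open CategoryTheory AlgebraicTopology Simplicial

/-- The `i`-th face of a singular simplex. -/
noncomputable def singularFace {X : Type*} [TopologicalSpace X] {n : ℕ} (i : Fin (n + 2))
    (τ : C(stdSimplex ℝ (Fin (n + 2)), X)) : C(stdSimplex ℝ (Fin (n + 1)), X) :=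
  τ.comp ⟨stdSimplex.map i.succAbove, stdSimplex.continuous_map _⟩

/-- The coefficient object `ℤ/2` of `H1ModTwo`. -/
abbrev coeffModTwo : ModuleCat.{u} (ZMod 2) :=
  ModuleCat.of (ZMod 2) (ULift.{u} (ZMod 2))

instance : Injective coeffModTwo.{u} := by
  have := Module.injective_of_isSemisimpleRing (ZMod 2) (ULift.{u} (ZMod 2))
  exact (Module.injective_iff_injective_object (ZMod 2) (ULift.{u} (ZMod 2))).mp this

/-- If `H₁(X; ℤ/2) = 0`, then every singular 1-cocycle modulo 2 is a coboundary. -/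
theorem exists_coboundary_of_subsingleton {X : Type u} [TopologicalSpace X]
    (h : Subsingleton (H1ModTwo X)) (φ : C(stdSimplex ℝ (Fin 2), X) → ZMod 2)
    (hφ : ∀ τ : C(stdSimplex ℝ (Fin 3), X),
      φ (singularFace 0 τ) + φ (singularFace 1 τ) + φ (singularFace 2 τ) = 0) :
    ∃ F : X → ZMod 2, ∀ σ : C(stdSimplex ℝ (Fin 2), X),
      φ σ = F (σ (stdSimplex.vertex 0)) + F (σ (stdSimplex.vertex 1)) := by
  let S := TopCat.toSSet.obj (TopCat.of X)
  let K := S.chainComplex coeffModTwo.{u}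
  have hK : (K.sc' 2 1 0).Exact := by
    rw [← K.exactAt_iff' 2 1 0 (by simp) (by simp), K.exactAt_iff_isZero_homology]
    exact ModuleCat.isZero_iff_subsingleton.mpr h
  let e (n : ℕ) := TopCat.toSSetObjEquiv (TopCat.of X) (.op ⦋n⦌)
  let Φ : K.X 1 ⟶ coeffModTwo.{u} := (S.isColimitChainComplexXCofan coeffModTwo 1).desc
    (Limits.Cofan.mk _ fun σ => φ (e 1 σ) • 𝟙 _)
  have hΦ (σ : S _⦋1⦌) : S.ιChainComplex σ ≫ Φ = φ (e 1 σ) • 𝟙 _ :=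
    (S.isColimitChainComplexXCofan coeffModTwo 1).fac _ ⟨σ⟩
  have hdΦ : K.d 2 1 ≫ Φ = 0 := by
    refine SSet.chainComplex_hom_ext fun τ => ?_
    obtain ⟨τ, rfl⟩ := (e 2).symm.surjective τ
    have hd : S.ιChainComplex ((e 2).symm τ) ≫ K.d 2 1 =
        ∑ i : Fin 3, (-1) ^ i.val • S.ιChainComplex ((e 1).symm (singularFace i τ)) :=
      S.ιChainComplex_d coeffModTwo (n := 1) _
    have h2 := hφ τ
    rw [Limits.comp_zero, ← Category.assoc, hd, Fin.sum_univ_three]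
    simp only [Preadditive.add_comp, Preadditive.neg_comp, hΦ, Equiv.apply_symm_apply,
      Fin.val_zero, Fin.val_one, Fin.val_two, pow_zero, pow_one, one_smul, neg_smul, even_two,
      Even.neg_pow, one_pow]
    rw [← neg_smul, CharTwo.neg_eq, ← add_smul, ← add_smul, h2, zero_smul]
  -- By exactness `Φ` vanishes on all cycles, so it factors through the boundaries in degree 0, and
  -- injectivity of the coefficients extends it to all 0-chains.
  let Ψ : K.X 0 ⟶ coeffModTwo.{u} := hK.descToInjective Φ hdΦ
  have hΨ : K.d 1 0 ≫ Ψ = Φ := hK.comp_descToInjective Φ hdΦ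
  let F : X → ZMod 2 := fun x =>
    ((S.ιChainComplex ((e 0).symm (ContinuousMap.const _ x)) ≫ Ψ).hom ⟨1⟩).down
  refine ⟨F, fun σ => ?_⟩
  have hd : S.ιChainComplex ((e 1).symm σ) ≫ K.d 1 0 =
      ∑ i : Fin 2, (-1) ^ i.val • S.ιChainComplex ((e 0).symm (singularFace i σ)) :=
    S.ιChainComplex_d coeffModTwo (n := 0) _
  have h1 := hΦ ((e 1).symm σ)
  rw [← hΨ, ← Category.assoc, hd, Fin.sum_univ_two] at h1
  have hc (i : Fin 2) : singularFace i σ =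
      ContinuousMap.const _ (σ (stdSimplex.vertex (i.succAbove 0))) := by
    ext x
    obtain rfl : x = stdSimplex.vertex 0 := Subsingleton.elim _ _
    simp [singularFace]
  rw [hc, hc] at h1
  have h2 := congrArg (fun f => (f.hom ⟨1⟩).down) h1
  simp [Preadditive.add_comp, CharTwo.neg_eq] at h2
  rw [← h2, add_comm]
  rfl

theorem simplyConnectedSpace_stdSimplex (n : ℕ) :
    SimplyConnectedSpace (stdSimplex ℝ (Fin (n + 1))) := by
  have := (convex_stdSimplex ℝ (Fin (n + 1))).contractibleSpace
    ⟨_, (stdSimplex.vertex (0 : Fin (n + 1))).2⟩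
  exact SimplyConnectedSpace.ofContractible _

theorem locallyPathConnectedSpace_stdSimplex (n : ℕ) :
    LocallyPathConnectedSpace (stdSimplex ℝ (Fin (n + 1))) :=
  (convex_stdSimplex ℝ (Fin (n + 1))).locallyPathConnectedSpace

/-- On a locally path connected space with `H₁(X; ℤ/2) = 0` every cocycle is a coboundary. -/
theorem exists_potAt_of_subsingleton_homology {X : Type u} [TopologicalSpace X]
    [LocallyPathConnectedSpace X] (h : Subsingleton (H1ModTwo X)) {g : X → X → ZMod 2}
    (hg : ∀ x, CocycleAt g x) : ∃ F, ∀ x, PotAt g F x := by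
  have := simplyConnectedSpace_stdSimplex
  have := locallyPathConnectedSpace_stdSimplex
  have hpot {n : ℕ} (σ : C(stdSimplex ℝ (Fin (n + 1)), X)) :=
    exists_potAt_of_simplyConnected (g := fun a b => g (σ a) (σ b))
      fun x => (hg (σ x)).comp σ.continuous.continuousAt
  choose P hP using @hpot
  -- Potentials on a connected simplex differ by a constant, so the sum over the two end points does
  -- not depend on the choice. In particular the three faces of a 2-simplex can all be computed from
  -- one potential on it.
  have hφ (σ : C(stdSimplex ℝ (Fin 2), X)) {f : stdSimplex ℝ (Fin 2) → ZMod 2}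
      (hf : ∀ x, PotAt (fun a b => g (σ a) (σ b)) f x) (x y : stdSimplex ℝ (Fin 2)) :
      P σ x + P σ y = f x + f y := by
    have := isPreconnected_univ.eq_of_eventually_eq (f := fun a => P σ a + f a)
      (fun x _ => (hP σ x).eventually_add_eq (hf x)) (Set.mem_univ x) (Set.mem_univ y)
    generalize P σ x = a at *
    generalize P σ y = b at *
    generalize f x = c at *
    generalize f y = d at *
    clear hf
    revert a b c d
    decide
  obtain ⟨F, hF⟩ := exists_coboundary_of_subsingleton h
    (fun σ => P σ (stdSimplex.vertex 0) + P σ (stdSimplex.vertex 1)) fun τ => by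
      have key (i : Fin 3) := hφ (singularFace i τ)
        (fun x => (hP τ _).comp (k := stdSimplex.map i.succAbove)
          (stdSimplex.continuous_map _).continuousAt)
        (stdSimplex.vertex 0) (stdSimplex.vertex 1)
      simp only [key, Function.comp_apply, stdSimplex.map_vertex]
      have e1 : (0 : Fin 3).succAbove (0 : Fin 2) = 1 := rfl
      have e2 : (0 : Fin 3).succAbove (1 : Fin 2) = 2 := rfl
      have e3 : (1 : Fin 3).succAbove (0 : Fin 2) = 0 := rfl
      have e4 : (1 : Fin 3).succAbove (1 : Fin 2) = 2 := rfl
      have e5 : (2 : Fin 3).succAbove (0 : Fin 2) = 0 := rfl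
      have e6 : (2 : Fin 3).succAbove (1 : Fin 2) = 1 := rfl
      rw [e1, e2, e3, e4, e5, e6]
      generalize P τ (stdSimplex.vertex 0) = a
      generalize P τ (stdSimplex.vertex 1) = b
      generalize P τ (stdSimplex.vertex 2) = c
      revert a b c
      decide
  refine ⟨F, fun x => ?_⟩
  obtain ⟨f, hf⟩ := hg x
  obtain ⟨U, hU, hxU, hfU⟩ := potAt_iff.mp hf
  -- A path inside `V` is a singular simplex on which both `F` and the local potential `f` compute
  -- the same number.
  obtain ⟨V, ⟨hV, hVc⟩, hVU⟩ := (path_connected_basis x).mem_iff.mp (hU.mem_nhds hxU)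
  refine potAt_of_forall hV fun a ha b hb => ?_
  obtain ⟨γ, hγ⟩ := hVc.joinedIn a ha b hb
  let σ : C(stdSimplex ℝ (Fin 2), X) := γ.toContinuousMap.comp
    ⟨stdSimplexHomeomorphUnitInterval, stdSimplexHomeomorphUnitInterval.continuous⟩
  have h0 : σ (stdSimplex.vertex 0) = a := by
    simp [σ]
  have h1 : σ (stdSimplex.vertex 1) = b := by
    simp [σ]
  have := (hF σ).symm.trans (hφ σ (f := f ∘ σ) (fun t => ?_) _ _)
  · rw [Function.comp_apply, Function.comp_apply, h0, h1] at this
    rw [this]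
    exact hfU a (hVU ha) b (hVU hb)
  · exact PotAt.comp (potAt_iff.mpr ⟨U, hU, hVU (hγ _), hfU⟩) σ.continuous.continuousAt

end SingularHomology

/-! ### Isolated singularities of cocycles -/

section Singularity

variable {X Y : Type*} [TopologicalSpace X] [TopologicalSpace Y]

/-- The cochain `g` is a cocycle on a punctured neighborhood of `x`. -/
def MildAt (g : X → X → ZMod 2) (x : X) : Prop :=
  ∀ᶠ y in 𝓝[≠] x, CocycleAt g y

/-- The cochain `g` is a coboundary on a punctured neighborhood of `x`. -/
def RemovableAt (g : X → X → ZMod 2) (x : X) : Prop :=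
  ∃ f, ∀ᶠ y in 𝓝[≠] x, PotAt g f y

/-- `x` has arbitrarily small open neighborhoods homeomorphic to the plane. -/
def PlanarAt (x : X) : Prop :=
  ∀ O ∈ 𝓝 x, ∃ j : ℂ → X, IsOpenEmbedding j ∧ j 0 = x ∧ Set.range j ⊆ O

theorem MildAt.add {g g' : X → X → ZMod 2} {x : X} (h : MildAt g x) (h' : MildAt g' x) :
    MildAt (g + g') x := by
  filter_upwards [h, h'] with y hy hy' using hy.add hy'

theorem RemovableAt.add {g g' : X → X → ZMod 2} {x : X} (h : RemovableAt g x)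
    (h' : RemovableAt g' x) : RemovableAt (g + g') x := by
  obtain ⟨f, hf⟩ := h
  obtain ⟨f', hf'⟩ := h'
  exact ⟨f + f', by filter_upwards [hf, hf'] with y hy hy' using hy.add hy'⟩

theorem CocycleAt.mildAt {g : X → X → ZMod 2} {x : X} (h : CocycleAt g x) : MildAt g x :=
  h.eventually.filter_mono nhdsWithin_le_nhds

theorem CocycleAt.removableAt {g : X → X → ZMod 2} {x : X} (h : CocycleAt g x) :
    RemovableAt g x :=
  ⟨_, h.choose_spec.eventually.filter_mono nhdsWithin_le_nhds⟩

/-- In logarithmic coordinates around an isolated singularity a cocycle has a potential, which is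
periodic up to a constant. -/
theorem exists_potAt_comp_exp {g : X → X → ZMod 2} {j : ℂ → X} (hj : IsOpenEmbedding j)
    (hg : ∀ z ≠ 0, CocycleAt g (j z)) :
    ∃ (F : ℂ → ZMod 2) (c : ZMod 2),
      (∀ z, PotAt (fun a b => g (j (Complex.exp a)) (j (Complex.exp b))) F z) ∧
      ∀ z, F (z + 2 * Real.pi * Complex.I) = F z + c := by
  have : SimplyConnectedSpace ℂ := SimplyConnectedSpace.ofContractible _
  have hc : Continuous fun z => j (Complex.exp z) := hj.continuous.comp Complex.continuous_exp
  obtain ⟨F, hF⟩ := exists_potAt_of_simplyConnected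
    (g := fun a b => g (j (Complex.exp a)) (j (Complex.exp b)))
    fun z => CocycleAt.comp (k := fun z => j (Complex.exp z)) (hg _ (Complex.exp_ne_zero z))
      hc.continuousAt
  have hF' (z : ℂ) : PotAt (fun a b => g (j (Complex.exp a)) (j (Complex.exp b)))
      (F ∘ (· + 2 * Real.pi * Complex.I)) z := by
    have := (hF (z + 2 * Real.pi * Complex.I)).comp (k := (· + 2 * Real.pi * Complex.I))
      (continuous_id.add continuous_const).continuousAt
    simpa only [Complex.exp_periodic _] using this
  refine ⟨F, F 0 + F (0 + 2 * Real.pi * Complex.I), hF, fun z => ?_⟩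
  have := isPreconnected_univ.eq_of_eventually_eq
    (f := fun a => F a + F (a + 2 * Real.pi * Complex.I))
    (fun x _ => (hF x).eventually_add_eq (hF' x)) (Set.mem_univ z) (Set.mem_univ 0)
  rw [← this, ← add_assoc, CharTwo.add_self_eq_zero, zero_add]

/-- Periodicity makes `F ∘ log` independent of the branch of the logarithm. Since `exp` carries
neighborhoods of `z` to neighborhoods of its image, the potential descends to the punctured plane.
-/
theorem removableAt_of_periodic {g : X → X → ZMod 2} {j : ℂ → X} (hj : IsOpenEmbedding j)
    {F : ℂ → ZMod 2}
    (hF : ∀ z, PotAt (fun a b => g (j (Complex.exp a)) (j (Complex.exp b))) F z)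
    (hp : ∀ z, F (z + 2 * Real.pi * Complex.I) = F z) : RemovableAt g (j 0) := by
  let f : X → ZMod 2 := fun x => F (Complex.log (Function.invFun j x))
  have hf (z : ℂ) : f (j (Complex.exp z)) = F z := by
    have h1 : f (j (Complex.exp z)) = F (Complex.log (Complex.exp z)) := by
      simp only [f, Function.leftInverse_invFun hj.injective (Complex.exp z)]
    rw [h1]
    obtain ⟨n, hn⟩ := Complex.exp_eq_exp_iff_exists_int.mp
      (Complex.exp_log (Complex.exp_ne_zero z))
    rw [hn]
    exact (Function.Periodic.int_mul (f := F) hp n) z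
  refine ⟨f, ?_⟩
  rw [eventually_nhdsWithin_iff]
  filter_upwards [hj.isOpen_range.mem_nhds ⟨0, rfl⟩] with y hy hne
  obtain ⟨w, rfl⟩ := hy
  have hw : w ≠ 0 := fun h => hne (by rw [h]; rfl)
  obtain ⟨z, rfl⟩ : ∃ z, Complex.exp z = w := ⟨_, Complex.exp_log hw⟩
  have hm : 𝓝 (j (Complex.exp z)) = map (fun z => j (Complex.exp z)) (𝓝 z) := by
    rw [← hj.map_nhds_eq,
      ← (Complex.hasStrictDerivAt_exp z).map_nhds_eq (Complex.exp_ne_zero z), map_map]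
    rfl
  unfold PotAt
  rw [hm, prod_map_map_eq, eventually_map]
  filter_upwards [hF z] with p hp
  rw [hf, hf]
  exact hp

/-- In the plane, the sum of two isolated singularities that are not removable is removable. -/
theorem RemovableAt.add_of_not {g g' : X → X → ZMod 2} {x : X} (hx : PlanarAt x)
    (hg : MildAt g x) (hg' : MildAt g' x) (h : ¬ RemovableAt g x) (h' : ¬ RemovableAt g' x) :
    RemovableAt (g + g') x := by
  obtain ⟨j, hj, rfl, hjO⟩ := hx _ (eventually_nhdsWithin_iff.mp (hg.and hg'))
  have hO (z : ℂ) (hz : z ≠ 0) := hjO ⟨z, rfl⟩ (fun h => hz (hj.injective h))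
  obtain ⟨F, c, hF, hc⟩ := exists_potAt_comp_exp hj fun z hz => (hO z hz).1
  obtain ⟨F', c', hF', hc'⟩ := exists_potAt_comp_exp hj fun z hz => (hO z hz).2
  have hc1 : c ≠ 0 := by
    rintro rfl
    exact h (removableAt_of_periodic hj hF (by simpa using hc))
  have hc1' : c' ≠ 0 := by
    rintro rfl
    exact h' (removableAt_of_periodic hj hF' (by simpa using hc'))
  refine removableAt_of_periodic (F := F + F') hj (fun z => (hF z).add (hF' z)) fun z => ?_
  have : ∀ a b : ZMod 2, a ≠ 0 → b ≠ 0 → a + b = 0 := by decide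
  rw [Pi.add_apply, Pi.add_apply, hc, hc', add_add_add_comm, this c c' hc1 hc1', add_zero]

open Classical in
/-- The index modulo 2 of `g` at `x`: it vanishes if and only if the singularity is removable. -/
noncomputable def singIndex (g : X → X → ZMod 2) (x : X) : ZMod 2 :=
  if RemovableAt g x then 0 else 1

theorem singIndex_eq_zero_iff {g : X → X → ZMod 2} {x : X} :
    singIndex g x = 0 ↔ RemovableAt g x := by
  unfold singIndex
  split_ifs with h <;> simp [h]

/-- Planarity matters only when neither singularity is removable: there each has monodromy 1 around
the puncture, and the two cancel. In the other cases the sum of any two of `g`, `g'`, `g + g'` is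
the third. -/
theorem singIndex_add {g g' : X → X → ZMod 2} {x : X} (hx : PlanarAt x)
    (hg : MildAt g x) (hg' : MildAt g' x) :
    singIndex (g + g') x = singIndex g x + singIndex g' x := by
  have e : g + (g + g') = g' := by rw [← add_assoc, cochain_add_self, zero_add]
  have e' : (g + g') + g' = g := by rw [add_assoc, cochain_add_self, add_zero]
  by_cases h : RemovableAt g x <;> by_cases h' : RemovableAt g' x
  · simp [singIndex, h, h', h.add h']
  · have : ¬ RemovableAt (g + g') x := fun h2 => h' (e ▸ h.add h2)
    simp [singIndex, h, h', this]
  · have : ¬ RemovableAt (g + g') x := fun h2 => h (e' ▸ h2.add h')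
    simp [singIndex, h, h', this]
  · have := RemovableAt.add_of_not hx hg hg' h h'
    simp only [singIndex, h, h', this, if_true, if_false]
    decide

theorem mildAt_zero (x : X) : MildAt (0 : X → X → ZMod 2) x :=
  CocycleAt.mildAt ⟨_, potAt_zero x⟩

theorem singIndex_of_cocycleAt {g : X → X → ZMod 2} {x : X} (h : CocycleAt g x) :
    singIndex g x = 0 :=
  singIndex_eq_zero_iff.mpr h.removableAt

theorem mildAt_sum {ι : Type*} {g : ι → X → X → ZMod 2} {x : X} (s : Finset ι)
    (hg : ∀ i ∈ s, MildAt (g i) x) : MildAt (∑ i ∈ s, g i) x := by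
  classical
  induction s using Finset.induction_on with
  | empty => simpa using mildAt_zero x
  | insert a s ha ih =>
    rw [Finset.sum_insert ha]
    exact (hg a (by simp)).add (ih fun i hi => hg i (by simp [hi]))

theorem singIndex_sum {ι : Type*} {g : ι → X → X → ZMod 2} {x : X} (hx : PlanarAt x)
    (s : Finset ι) (hg : ∀ i ∈ s, MildAt (g i) x) :
    singIndex (∑ i ∈ s, g i) x = ∑ i ∈ s, singIndex (g i) x := by
  classical
  induction s using Finset.induction_on with
  | empty => simpa using singIndex_of_cocycleAt ⟨_, potAt_zero x⟩
  | insert a s ha ih =>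
    rw [Finset.sum_insert ha, Finset.sum_insert ha,
      singIndex_add hx (hg a (by simp)) (mildAt_sum s fun i hi => hg i (by simp [hi])),
      ih fun i hi => hg i (by simp [hi])]

theorem cocycleAt_sum {ι : Type*} {g : ι → X → X → ZMod 2} {x : X} (s : Finset ι)
    (hg : ∀ i ∈ s, CocycleAt (g i) x) : CocycleAt (∑ i ∈ s, g i) x := by
  classical
  induction s using Finset.induction_on with
  | empty => simpa using ⟨_, potAt_zero x⟩
  | insert a s ha ih =>
    rw [Finset.sum_insert ha]
    exact (hg a (by simp)).add (ih fun i hi => hg i (by simp [hi]))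

theorem potAt_sum {ι : Type*} {g : ι → X → X → ZMod 2} {f : ι → X → ZMod 2} {x : X} (s : Finset ι)
    (hg : ∀ i ∈ s, PotAt (g i) (f i) x) : PotAt (∑ i ∈ s, g i) (∑ i ∈ s, f i) x := by
  classical
  induction s using Finset.induction_on with
  | empty => simpa using potAt_zero x
  | insert a s ha ih =>
    rw [Finset.sum_insert ha, Finset.sum_insert ha]
    exact (hg a (by simp)).add (ih fun i hi => hg i (by simp [hi]))

/-- A removable singularity can be removed, without changing the cochain near the diagonal
elsewhere. -/
theorem exists_cocycleAt_of_removableAt [T3Space X] {g : X → X → ZMod 2} {x : X}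
    (h : RemovableAt g x) : ∃ g' : X → X → ZMod 2, CocycleAt g' x ∧
      ∀ y ≠ x, ∀ f, PotAt g f y → PotAt g' f y := by
  classical
  obtain ⟨f, hf⟩ := h
  obtain ⟨U, hU, hUo, hxU⟩ := mem_nhds_iff.mp (eventually_nhdsWithin_iff.mp hf)
  obtain ⟨K, hK, hKc, hKU⟩ := exists_mem_nhds_isClosed_subset (hUo.mem_nhds hxU)
  -- Replacing `g` by the coboundary of `f` on `K` changes nothing near the diagonal at points of
  -- `K` other than `x`, where both already agree. This covers the frontier of `K`, which lies in
  -- `K` because `K` is closed.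
  refine ⟨fun a b => if a ∈ K ∧ b ∈ K then f a + f b else g a b, ⟨f, ?_⟩, fun y hy f' hf' => ?_⟩
  · exact potAt_of_forall hK fun a ha b hb => if_pos ⟨ha, hb⟩
  · by_cases hyK : y ∈ K
    · have h1 : PotAt g f y := hU (hKU hyK) hy
      filter_upwards [h1, hf'] with p hp hp'
      split_ifs
      · rw [← hp, hp']
      · exact hp'
    · filter_upwards [hf', prod_mem_prod (hKc.isOpen_compl.mem_nhds hyK)
        (hKc.isOpen_compl.mem_nhds hyK)] with p hp hp'
      rw [if_neg fun h => hp'.1 h.1]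
      exact hp

/-- Finitely many removable singularities can be removed. -/
theorem exists_cocycleAt_of_finite [T3Space X] {s : Set X} (hs : s.Finite) :
    ∀ g : X → X → ZMod 2, (∀ x ∈ s, RemovableAt g x) → (∀ x ∉ s, CocycleAt g x) →
      ∃ g' : X → X → ZMod 2, (∀ x, CocycleAt g' x) ∧
        ∀ y ∉ s, ∀ f, PotAt g f y → PotAt g' f y := by
  induction s, hs using Set.Finite.induction_on with
  | empty => exact fun g _ h => ⟨g, fun x => h x (by simp), fun _ _ _ h => h⟩
  | @insert a s ha hs ih =>
    intro g h h'
    obtain ⟨g₁, h₁, hg₁⟩ := exists_cocycleAt_of_removableAt (h a (by simp))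
    have hrem : ∀ x ∈ s, RemovableAt g₁ x := by
      intro x hx
      obtain ⟨f, hf⟩ := h x (by simp [hx])
      refine ⟨f, ?_⟩
      have hxa : x ≠ a := fun h => ha (h ▸ hx)
      filter_upwards [hf, nhdsWithin_le_nhds (isOpen_ne.mem_nhds hxa)] with y hy hya
      exact hg₁ y hya f hy
    have hcoc : ∀ x ∉ s, CocycleAt g₁ x := by
      intro x hx
      by_cases hxa : x = a
      · exact hxa ▸ h₁
      · obtain ⟨f, hf⟩ := h' x (by simp [hxa, hx])
        exact ⟨f, hg₁ x hxa f hf⟩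
    obtain ⟨g₂, h₂, hg₂⟩ := ih g₁ hrem hcoc
    refine ⟨g₂, h₂, fun y hy f hf => ?_⟩
    rw [Set.mem_insert_iff, not_or] at hy
    exact hg₂ y hy.2 f (hg₁ y hy.1 f hf)

end Singularity

/-! ### Cut cochains -/

section Cut

open Classical in
/-- The cochain that counts crossings between `Q` and its complement inside `A`. -/
noncomputable def cutCochain {X : Type*} (A Q : Set X) (a b : X) : ZMod 2 :=
  if a ∈ A ∧ b ∈ A then Q.indicator 1 a + Q.indicator 1 b else 0

theorem cutCochain_congr {X Y : Type*} {A Q : Set X} {A' Q' : Set Y} {a b : X} {a' b' : Y}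
    (ha : a ∈ A ↔ a' ∈ A') (hb : b ∈ A ↔ b' ∈ A') (hqa : a ∈ Q ↔ a' ∈ Q')
    (hqb : b ∈ Q ↔ b' ∈ Q') : cutCochain A Q a b = cutCochain A' Q' a' b' := by
  classical
  simp only [cutCochain, Set.indicator_apply, Pi.one_apply, ha, hb, hqa, hqb]

theorem cutCochain_image {X Y : Type*} {k : Y → X} (hk : Function.Injective k) (A Q : Set Y)
    (a b : Y) :
    cutCochain (k '' A) (k '' Q) (k a) (k b) = cutCochain A Q a b := by
  classical
  simp only [cutCochain, hk.mem_set_image, Set.indicator_apply, Pi.one_apply]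

variable {X : Type*} [TopologicalSpace X]

theorem potAt_cutCochain_of_mem_nhds {A Q : Set X} {x : X} (hA : A ∈ 𝓝 x) :
    PotAt (cutCochain A Q) (Q.indicator 1) x :=
  potAt_of_forall hA fun _ ha _ hb => if_pos ⟨ha, hb⟩

/-- Where `A` lies locally on one side of the cut, leaving `A` does no harm. Hence a cut can be
singular only at its ends, where the frontiers of `A` and `Q` meet. -/
theorem potAt_cutCochain_zero_of_subset {A Q : Set X} {x : X}
    (h : ∀ᶠ a in 𝓝 x, a ∈ A → a ∈ Q) : PotAt (cutCochain A Q) 0 x := by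
  refine potAt_of_forall h fun a ha b hb => ?_
  unfold cutCochain
  split_ifs with hab
  · rw [Set.indicator_of_mem (ha hab.1), Set.indicator_of_mem (hb hab.2)]
    exact CharTwo.add_self_eq_zero _
  · simp

theorem potAt_cutCochain_zero_of_disjoint {A Q : Set X} {x : X}
    (h : ∀ᶠ a in 𝓝 x, a ∈ A → a ∉ Q) : PotAt (cutCochain A Q) 0 x := by
  refine potAt_of_forall h fun a ha b hb => ?_
  unfold cutCochain
  split_ifs with hab
  · rw [Set.indicator_of_notMem (ha hab.1), Set.indicator_of_notMem (hb hab.2)]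
    simp
  · simp

/-- The local model of a singularity that is not removable: the end point of a cut. -/
theorem not_removableAt_of_model {g : X → X → ZMod 2} {J : ℝ × ℝ → X} (hJ : Continuous J)
    (hinj : ∀ᶠ v in 𝓝 (0 : ℝ × ℝ), J v = J 0 → v = 0)
    (hmodel : ∀ᶠ p in 𝓝 (0 : ℝ × ℝ) ×ˢ 𝓝 (0 : ℝ × ℝ),
      g (J p.1) (J p.2) = cutCochain {v : ℝ × ℝ | v.1 < 0} {v | 0 ≤ v.2} p.1 p.2) :
    ¬ RemovableAt g (J 0) := by
  rintro ⟨f, hf⟩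
  have h1 : ∀ᶠ v in 𝓝 (0 : ℝ × ℝ), v ≠ 0 →
      PotAt (fun a b => g (J a) (J b)) (f ∘ J) v := by
    filter_upwards [hinj, hJ.continuousAt.eventually (eventually_nhdsWithin_iff.mp hf)]
      with v hv hv' hv0
    exact (hv' fun h => hv0 (hv h)).comp hJ.continuousAt
  obtain ⟨U, hU, hUm⟩ := (nhds_basis_opens (0 : ℝ × ℝ)).prod_self.eventually_iff.mp hmodel
  obtain ⟨ε, hε, hball⟩ := Metric.mem_nhds_iff.mp (inter_mem h1 (hU.2.mem_nhds hU.1))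
  have hS {a b : ℝ} (ha : |a| < ε) (hb : |b| < ε) : ((a, b) : ℝ × ℝ) ∈ Metric.ball (0 : ℝ × ℝ) ε := by
    rw [mem_ball_zero_iff, Prod.norm_def]
    exact max_lt ha hb
  have hm (a b : ℝ × ℝ) (ha : a ∈ Metric.ball (0 : ℝ × ℝ) ε) (hb : b ∈ Metric.ball (0 : ℝ × ℝ) ε) :
      g (J a) (J b) = cutCochain {v : ℝ × ℝ | v.1 < 0} {v | 0 ≤ v.2} a b :=
    hUm (x := (a, b)) ⟨(hball ha).2, (hball hb).2⟩
  -- Off the cut `g` vanishes near the diagonal, so a potential is constant on convex regions that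
  -- avoid the cut. The upper, right and lower half planes lead from one side of the cut to the
  -- other around its end.
  have hconst {O : Set (ℝ × ℝ)} (hO : IsOpen O) (hOc : Convex ℝ O) (hO0 : (0 : ℝ × ℝ) ∉ O)
      (hOm : (∀ v ∈ O, v.1 < 0 → v ∈ {v : ℝ × ℝ | 0 ≤ v.2}) ∨
        (∀ v ∈ O, v.1 < 0 → v ∉ {v : ℝ × ℝ | 0 ≤ v.2}))
      {a b : ℝ × ℝ} (ha : a ∈ Metric.ball (0 : ℝ × ℝ) ε ∩ O)
      (hb : b ∈ Metric.ball (0 : ℝ × ℝ) ε ∩ O) : f (J a) = f (J b) := by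
    refine (((convex_ball (0 : ℝ × ℝ) ε).inter hOc).isPreconnected).eq_of_eventually_eq
      (f := f ∘ J) (fun x hx => ?_) ha hb
    have hx0 : x ≠ 0 := fun h => hO0 (h ▸ hx.2)
    have hp := (hball hx.1).1 hx0
    have hc : PotAt (cutCochain {v : ℝ × ℝ | v.1 < 0} {v | 0 ≤ v.2}) 0 x := by
      rcases hOm with h | h
      · exact potAt_cutCochain_zero_of_subset (mem_of_superset (hO.mem_nhds hx.2) h)
      · exact potAt_cutCochain_zero_of_disjoint (mem_of_superset (hO.mem_nhds hx.2) h)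
    have hB := Metric.isOpen_ball.mem_nhds hx.1
    refine potAt_zero_iff.mp ?_
    filter_upwards [hp, hc, prod_mem_prod hB hB] with p hp1 hp2 hp3
    rw [← hp1, hm _ _ hp3.1 hp3.2, hp2]
    simp
  have hε2 : |ε / 2| < ε := by rw [abs_of_pos (by linarith)]; linarith
  have hε2' : |-(ε / 2)| < ε := by rwa [abs_neg]
  obtain ⟨V, hV, hxV, hVp⟩ := potAt_iff.mp ((hball (hS hε2' (by simpa using hε))).1
    (fun h => by simp [Prod.ext_iff] at h; linarith) : PotAt _ _ (-(ε / 2), (0 : ℝ)))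
  have hcont : Tendsto (fun η : ℝ => ((-(ε / 2), η) : ℝ × ℝ)) (𝓝 0) (𝓝 (-(ε / 2), 0)) :=
    (Continuous.prodMk_right _).tendsto' _ _ rfl
  have hcont' : Tendsto (fun η : ℝ => ((-(ε / 2), -η) : ℝ × ℝ)) (𝓝 0) (𝓝 (-(ε / 2), 0)) :=
    ((Continuous.prodMk_right _).comp continuous_neg).tendsto' _ _ (by simp)
  obtain ⟨η, ⟨⟨h2, h3⟩, h4⟩, h5⟩ := ((((hcont.eventually (hV.mem_nhds hxV)).and
    (hcont'.eventually (hV.mem_nhds hxV))).and (gt_mem_nhds hε)).filter_mono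
      nhdsWithin_le_nhds |>.and (self_mem_nhdsWithin (s := Set.Ioi (0 : ℝ)))).exists
  have h5 : 0 < η := h5
  have hη : |η| < ε := by rwa [abs_of_pos h5]
  have hη' : |-η| < ε := by rwa [abs_neg]
  have e1 : f (J (-(ε / 2), η)) = f (J (ε / 2, η)) :=
    hconst (O := {v | 0 < v.2}) (isOpen_lt continuous_const continuous_snd)
      (convex_halfSpace_gt (LinearMap.snd ℝ ℝ ℝ).isLinear 0) (by simp)
      (.inl fun v (hv : 0 < v.2) _ => hv.le) ⟨hS hε2' hη, h5⟩ ⟨hS hε2 hη, h5⟩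
  have e2 : f (J (ε / 2, η)) = f (J (ε / 2, -η)) :=
    hconst (O := {v | 0 < v.1}) (isOpen_lt continuous_const continuous_fst)
      (convex_halfSpace_gt (LinearMap.fst ℝ ℝ ℝ).isLinear 0) (by simp)
      (.inl fun v (hv : 0 < v.1) hv' => (lt_asymm hv hv').elim) ⟨hS hε2 hη, half_pos hε⟩
      ⟨hS hε2 hη', half_pos hε⟩
  have e3 : f (J (ε / 2, -η)) = f (J (-(ε / 2), -η)) :=
    hconst (O := {v | v.2 < 0}) (isOpen_lt continuous_snd continuous_const)
      (convex_halfSpace_lt (LinearMap.snd ℝ ℝ ℝ).isLinear 0) (by simp)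
      (.inr fun v (hv : v.2 < 0) _ => not_le_of_gt hv) ⟨hS hε2 hη', neg_lt_zero.mpr h5⟩
      ⟨hS hε2' hη', neg_lt_zero.mpr h5⟩
  -- The points above and below the cut have equal potential by the way around the end, while `g` is
  -- 1 on this pair.
  have e4 := hVp _ h2 _ h3
  rw [hm _ _ (hS hε2' hη) (hS hε2' hη'), Function.comp_apply, Function.comp_apply, e1, e2, e3,
    CharTwo.add_self_eq_zero] at e4
  have : -(ε / 2) < 0 := by linarith
  simp [cutCochain, this, h5.le, h5] at e4

/-- The cut along the segment from `-1` to `1` in a planar chart: a cocycle whose only singularities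
are the two end points. -/
theorem exists_cut_of_isOpenEmbedding {j : ℂ → X} [T2Space X] (hj : IsOpenEmbedding j) :
    ∃ g : X → X → ZMod 2, (∀ x, x ∉ Set.range j → PotAt g 0 x) ∧
      (∀ x, x ≠ j 1 → x ≠ j (-1) → CocycleAt g x) ∧
      ¬ RemovableAt g (j 1) ∧ ¬ RemovableAt g (j (-1)) := by
  -- The frontier of `Q` meets the open square `A` in the open segment from `-1` to `1`. As `A` is
  -- bounded, the cut stays in the compact set `j '' K`, closed in `X`, and extends by zero.
  let A : Set ℂ := {z | |z.re| < 1 ∧ |z.im| < 1}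
  let Q : Set ℂ := {z | 0 ≤ z.im}
  have hA : IsOpen A :=
    (isOpen_lt (f := fun z : ℂ => |z.re|) (by fun_prop) continuous_const).inter
      (isOpen_lt (f := fun z : ℂ => |z.im|) (by fun_prop) continuous_const)
  let K : Set ℂ := Metric.closedBall 0 2
  have hAK : A ⊆ K := by
    intro z hz
    simp only [K, mem_closedBall_zero_iff]
    refine (Complex.norm_le_abs_re_add_abs_im z).trans ?_
    linarith [hz.1, hz.2]
  have hK : IsClosed (j '' K) :=
    ((isCompact_closedBall (0 : ℂ) 2).image hj.continuous).isClosed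
  have hout (x : X) (hx : x ∉ j '' K) : PotAt (cutCochain (j '' A) (j '' Q)) 0 x :=
    potAt_cutCochain_zero_of_subset (mem_of_superset (hK.isOpen_compl.mem_nhds hx)
      fun y hy hyA => (hy (Set.image_mono hAK hyA)).elim)
  have key (s : ℝ) (hs : |s| = 1) : ¬ RemovableAt (cutCochain (j '' A) (j '' Q)) (j s) := by
    -- The factor `s` points the first coordinate outwards at both ends `s = 1` and `s = -1`, so
    -- that `A` becomes `v.1 < 0`.
    let J : ℝ × ℝ → X := fun v => j (s * (1 + v.1) + v.2 * Complex.I)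
    have hJ : Continuous J := hj.continuous.comp (by fun_prop)
    have h0 : J 0 = j s := by simp [J]
    have hs0 : s ≠ 0 := by rintro rfl; simp at hs
    rw [← h0]
    refine not_removableAt_of_model hJ (Eventually.of_forall fun v hv => ?_) ?_
    · have := hj.injective hv
      simpa [Complex.ext_iff, Prod.ext_iff, hs0] using this
    · have hB : Metric.ball (0 : ℝ × ℝ) 1 ∈ 𝓝 (0 : ℝ × ℝ) := Metric.ball_mem_nhds _ one_pos
      filter_upwards [prod_mem_prod hB hB] with p hp
      have hv (v : ℝ × ℝ) (hv : v ∈ Metric.ball (0 : ℝ × ℝ) 1) :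
          (s * (1 + v.1) + v.2 * Complex.I ∈ A ↔ v ∈ {v : ℝ × ℝ | v.1 < 0}) := by
        rw [mem_ball_zero_iff, Prod.norm_def, max_lt_iff, Real.norm_eq_abs, Real.norm_eq_abs,
          abs_lt] at hv
        change |(s * (1 + v.1) + v.2 * Complex.I : ℂ).re| < 1 ∧
          |(s * (1 + v.1) + v.2 * Complex.I : ℂ).im| < 1 ↔ v.1 < 0
        have e1 : (s * (1 + v.1) + v.2 * Complex.I : ℂ).re = s * (1 + v.1) := by simp
        have e2 : (s * (1 + v.1) + v.2 * Complex.I : ℂ).im = v.2 := by simp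
        rw [e1, e2, abs_mul, hs, one_mul, abs_of_pos (by linarith [hv.1.1])]
        constructor
        · intro h
          linarith [h.1]
        · intro h
          exact ⟨by linarith, hv.2⟩
      simp only [J]
      rw [cutCochain_image hj.injective]
      simp only [cutCochain, hv _ hp.1, hv _ hp.2]
      congr 1
      simp [Set.indicator_apply, Q]
  refine ⟨cutCochain (j '' A) (j '' Q), fun x hx => hout x fun h => hx (Set.image_subset_range _ _ h),
    fun x h1 h2 => ?_, ?_, ?_⟩
  · by_cases hxK : x ∈ j '' K
    · obtain ⟨z, -, rfl⟩ := hxK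
      by_cases hz : z ∈ A
      · exact ⟨_, potAt_cutCochain_of_mem_nhds ((hj.isOpenMap _ hA).mem_nhds ⟨z, hz, rfl⟩)⟩
      refine ⟨0, ?_⟩
      have key {P : Set ℂ} (hP : IsOpen P) (hzP : z ∈ P) : j '' P ∈ 𝓝 (j z) :=
        (hj.isOpenMap _ hP).mem_nhds ⟨z, hzP, rfl⟩
      rcases lt_trichotomy z.im 0 with him | him | him
      · refine potAt_cutCochain_zero_of_disjoint (mem_of_superset
          (key (isOpen_lt Complex.continuous_im continuous_const) him) ?_)
        rintro _ ⟨w, hw, rfl⟩ -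
        rw [hj.injective.mem_set_image]
        exact not_le_of_gt (show w.im < 0 from hw)
      · have hre : 1 < |z.re| := by
          refine lt_of_le_of_ne (not_lt.mp fun h => hz ⟨h, by simp [him]⟩) fun h => ?_
          rcases eq_or_eq_neg_of_abs_eq h.symm with h | h
          · exact h1 (congrArg j (Complex.ext h him))
          · exact h2 (congrArg j (Complex.ext h (by simp [him])))
        refine potAt_cutCochain_zero_of_subset (mem_of_superset
          (key (P := {z | 1 < |z.re|}) (isOpen_lt continuous_const (by fun_prop)) hre) ?_)
        rintro _ ⟨w, hw, rfl⟩ hwA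
        rw [hj.injective.mem_set_image] at hwA
        exact (lt_asymm hw hwA.1).elim
      · refine potAt_cutCochain_zero_of_subset (mem_of_superset
          (key (isOpen_lt continuous_const Complex.continuous_im) him) ?_)
        rintro _ ⟨w, hw, rfl⟩ -
        rw [hj.injective.mem_set_image]
        exact le_of_lt (show 0 < w.im from hw)
    · exact ⟨0, hout x hxK⟩
  · simpa using key 1 (by simp)
  · simpa using key (-1) (by simp)

end Cut

/-! ### Linking points by cuts away from a closed set -/

section Linked

variable {X : Type*} [TopologicalSpace X]

/-- `p` and `q` are the end points of a cut that avoids `B`. -/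
def Linked (B : Set X) (p q : X) : Prop :=
  ∃ g : X → X → ZMod 2, (∀ x ∈ B, PotAt g 0 x) ∧ (∀ x, MildAt g x) ∧
    ∀ x ∉ B, singIndex g x = Set.indicator {p} 1 x + Set.indicator {q} 1 x

theorem linked_refl (B : Set X) (p : X) : Linked B p p :=
  ⟨0, fun x _ => potAt_zero x, fun x => mildAt_zero x, fun x _ => by
    rw [singIndex_of_cocycleAt ⟨_, potAt_zero x⟩, CharTwo.add_self_eq_zero]⟩

theorem Linked.symm {B : Set X} {p q : X} (h : Linked B p q) : Linked B q p := by
  obtain ⟨g, h1, h2, h3⟩ := h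
  exact ⟨g, h1, h2, fun x hx => (h3 x hx).trans (add_comm _ _)⟩

/-- The cuts are added; the two ends at `q` cancel modulo 2, by additivity of the index at planar
points. -/
theorem Linked.trans {B : Set X} (hB : ∀ x ∉ B, PlanarAt x) {p q r : X} (h : Linked B p q)
    (h' : Linked B q r) : Linked B p r := by
  obtain ⟨g, h1, h2, h3⟩ := h
  obtain ⟨g', h1', h2', h3'⟩ := h'
  refine ⟨g + g', fun x hx => by simpa using (h1 x hx).add (h1' x hx),
    fun x => (h2 x).add (h2' x), fun x hx => ?_⟩
  rw [singIndex_add (hB x hx) (h2 x) (h2' x), h3 x hx, h3' x hx, add_assoc,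
    ← add_assoc (Set.indicator {q} 1 x), CharTwo.add_self_eq_zero, zero_add]

theorem linked_of_isOpenEmbedding [T2Space X] {B : Set X} {j : ℂ → X} (hj : IsOpenEmbedding j)
    (hjB : Disjoint (Set.range j) B) : Linked B (j 1) (j (-1)) := by
  obtain ⟨g, h1, h2, h3, h4⟩ := exists_cut_of_isOpenEmbedding hj
  have hne : j 1 ≠ j (-1) := fun h => by
    have := congrArg Complex.re (hj.injective h)
    norm_num at this
  have hmild (x : X) : MildAt g x := by
    have hU : ∀ᶠ y in 𝓝[≠] x, y ≠ j 1 ∧ y ≠ j (-1) := by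
      have h (c : X) : ∀ᶠ y in 𝓝[≠] x, y ≠ c := by
        by_cases hx : x = c
        · subst hx; exact self_mem_nhdsWithin
        · exact nhdsWithin_le_nhds (isOpen_ne.mem_nhds hx)
      exact (h _).and (h _)
    exact hU.mono fun y hy => h2 y hy.1 hy.2
  refine ⟨g, fun x hx => h1 x (Set.disjoint_right.mp hjB hx), hmild, fun x _ => ?_⟩
  by_cases hx1 : x = j 1
  · subst hx1
    simp [hne, singIndex, h3]
  · by_cases hx2 : x = j (-1)
    · subst hx2
      simp [hne.symm, singIndex, h4]
    · rw [singIndex_of_cocycleAt (h2 x hx1 hx2)]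
      simp [hx1, hx2]

theorem eventually_linked [T2Space X] {B : Set X} (hBc : IsClosed B) {p : X} (hp : p ∉ B)
    (hpl : PlanarAt p) : ∀ᶠ q in 𝓝 p, Linked B q p := by
  obtain ⟨j, hj, rfl, hjB⟩ := hpl _ (hBc.isOpen_compl.mem_nhds hp)
  filter_upwards [hj.isOpen_range.mem_nhds ⟨0, rfl⟩] with q hq
  obtain ⟨w, rfl⟩ := hq
  by_cases hw : w = 0
  · rw [hw]
    exact linked_refl _ _
  · have hw2 : w / 2 ≠ 0 := div_ne_zero hw two_ne_zero
    -- The affine map that carries the ends `1` and `-1` of the standard cut to `w` and `0`.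
    let e : ℂ ≃ₜ ℂ := (Homeomorph.addRight (1 : ℂ)).trans (Homeomorph.mulLeft₀ (w / 2) hw2)
    have := linked_of_isOpenEmbedding (B := B) (hj.comp e.isOpenEmbedding)
      (Set.disjoint_of_subset_left (Set.range_comp_subset_range _ _)
        (Set.disjoint_left.mpr fun x hx => hjB hx))
    have e1 : e 1 = w := by
      change w / 2 * (1 + 1) = w
      ring
    have e2 : e (-1) = 0 := by
      change w / 2 * (-1 + 1) = 0
      ring
    rwa [Function.comp_apply, Function.comp_apply, e1, e2] at this

/-- Nearby points are linked, so being linked to `p` is a locally constant condition along `Z`. This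
replaces the choice of an arc from `p` to `q`. -/
theorem IsPreconnected.linked [T2Space X] {B : Set X} (hBc : IsClosed B)
    (hB : ∀ x ∉ B, PlanarAt x) {Z : Set X} (hZ : IsPreconnected Z) (hZB : Disjoint Z B) {p q : X}
    (hp : p ∈ Z) (hq : q ∈ Z) : Linked B p q := by
  classical
  have := hZ.eq_of_eventually_eq (f := fun x => if Linked B p x then 1 else 0)
    (fun x hx => by
      have hxB : x ∉ B := Set.disjoint_left.mp hZB hx
      filter_upwards [eventually_linked hBc hxB (hB x hxB)] with y hy
      have : Linked B p y ↔ Linked B p x :=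
        ⟨fun h => h.trans hB hy, fun h => h.trans hB hy.symm⟩
      simp only [this]) hp hq
  by_contra h
  simp [linked_refl, h] at this

/-- Each point has a neighborhood in which no other point is singular, and finitely many of these
cover `X`. -/
theorem finite_not_cocycleAt [CompactSpace X] {g : X → X → ZMod 2} (hg : ∀ x, MildAt g x) :
    {x | ¬ CocycleAt g x}.Finite := by
  obtain ⟨t, -, ht⟩ := isCompact_univ.elim_nhds_subcover (fun x => {y | y ≠ x → CocycleAt g y})
    fun x _ => eventually_nhdsWithin_iff.mp (hg x)
  refine t.finite_toSet.subset fun x hx => ?_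
  obtain ⟨y, hy, hxy⟩ := Set.mem_iUnion₂.mp (ht (Set.mem_univ x))
  by_cases h : x = y
  · rw [h]
    exact hy
  · exact (hx (hxy h)).elim

end Linked

/-! ### Local structure of 2-stratifolds -/

section Stratifold

variable {X : Type*} [TopologicalSpace X] {X₁ : Set X}

theorem IsTwoStratifold.planarAt (hX : IsTwoStratifold X₁) {x : X} (hx : x ∉ X₁) :
    PlanarAt x := by
  intro O hO
  obtain ⟨U, hU, hxU, ⟨h⟩⟩ := hX.regular x hx
  let k : EuclideanSpace ℝ (Fin 2) → X := Subtype.val ∘ h.symm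
  have hk : IsOpenEmbedding k := hU.isOpenEmbedding_subtypeVal.comp h.symm.isOpenEmbedding
  let c := h ⟨x, hxU⟩
  have hc : k c = x := by simp [k, c]
  have hO' : k ⁻¹' O ∈ 𝓝 c := hk.continuous.continuousAt (by rwa [hc])
  obtain ⟨r, hr, hball⟩ := Metric.mem_nhds_iff.mp hO'
  let b := OpenPartialHomeomorph.univBall c r
  have hb : IsOpenEmbedding b := b.isOpenEmbedding (OpenPartialHomeomorph.univBall_source c r)
  let e : ℂ ≃ₜ EuclideanSpace ℝ (Fin 2) :=
    Complex.orthonormalBasisOneI.repr.toHomeomorph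
  refine ⟨k ∘ b ∘ e, hk.comp (hb.comp e.isOpenEmbedding), ?_, ?_⟩
  · have : e 0 = 0 := map_zero Complex.orthonormalBasisOneI.repr
    simp only [Function.comp_apply, this, b, OpenPartialHomeomorph.univBall_apply_zero, hc]
  · rintro _ ⟨z, rfl⟩
    refine hball ?_
    rw [← OpenPartialHomeomorph.univBall_target c hr]
    exact b.map_source (by simp [b])

theorem LocallyPathConnectedSpace.of_forall_open {X : Type*} [TopologicalSpace X]
    (h : ∀ x : X, ∃ U : Set X, IsOpen U ∧ x ∈ U ∧ LocallyPathConnectedSpace U) :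
    LocallyPathConnectedSpace X := by
  refine ⟨fun x => hasBasis_self.mpr fun s hs => ?_⟩
  obtain ⟨U, hU, hxU, hUl⟩ := h x
  have hs' : Subtype.val ⁻¹' s ∈ 𝓝 (⟨x, hxU⟩ : U) := continuous_subtype_val.continuousAt hs
  obtain ⟨t, ⟨ht, htc⟩, hts⟩ := (path_connected_basis (⟨x, hxU⟩ : U)).mem_iff.mp hs'
  refine ⟨Subtype.val '' t, ?_, htc.image continuous_subtype_val, Set.image_subset_iff.mpr hts⟩
  exact hU.isOpenEmbedding_subtypeVal.isOpenMap.image_mem_nhds ht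

theorem locallyPathConnectedSpace_openCone (d : ℕ) : LocallyPathConnectedSpace (OpenCone d) := by
  have : LocallyPathConnectedSpace NNReal :=
    (convex_Ici (0 : ℝ)).locallyPathConnectedSpace
  have : LocallyPathConnectedSpace (Fin d) := inferInstance
  exact Quot.locallyPathConnectedSpace

theorem IsTwoStratifold.locallyPathConnectedSpace (hX : IsTwoStratifold X₁) :
    LocallyPathConnectedSpace X := by
  refine .of_forall_open fun x => ?_
  by_cases hx : x ∈ X₁
  · obtain ⟨U, hU, hxU, d, -, h, -⟩ := hX.singular x hx
    have := locallyPathConnectedSpace_openCone d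
    exact ⟨U, hU, hxU, h.isOpenEmbedding.locallyPathConnectedSpace⟩
  · obtain ⟨U, hU, hxU, ⟨h⟩⟩ := hX.regular x hx
    exact ⟨U, hU, hxU, h.isOpenEmbedding.locallyPathConnectedSpace⟩

end Stratifold

/-! ### Coordinates on mapping cylinders -/

namespace CoverCylinder

variable {r : ℕ} {n : Fin r → ℕ}

/-- The point `z` of the core circle. -/
def corePoint (n : Fin r → ℕ) (z : Circle) : CoverCylinder n :=
  Quot.mk _ (Sum.inr z)

theorem continuous_corePoint : Continuous (corePoint n) :=
  continuous_quot_mk.comp continuous_inr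

theorem continuous_point (i : Fin r) :
    Continuous fun p : Circle × unitInterval => point n i p.1 p.2 :=
  continuous_quot_mk.comp (continuous_inl.comp (Continuous.prodMk_right i))

theorem point_zero (i : Fin r) (z : Circle) : point n i z 0 = corePoint n (z ^ n i) :=
  Quot.sound ⟨i, z, rfl, rfl⟩

theorem eq_corePoint_or_eq_point (y : CoverCylinder n) :
    (∃ z, y = corePoint n z) ∨ ∃ i z t, y = point n i z t := by
  induction y using Quot.ind with
  | mk a =>
    rcases a with ⟨i, z, t⟩ | z
    · exact .inr ⟨i, z, t, rfl⟩
    · exact .inl ⟨z, rfl⟩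

/-- The height above the core circle. -/
def height : CoverCylinder n → ℝ :=
  Quot.lift (Sum.elim (fun p => p.2.2) fun _ => 0) (by rintro _ _ ⟨i, z, rfl, rfl⟩; rfl)

/-- The height above the core circle in the `i`-th sheet; it vanishes on the other sheets. -/
def sheetHeight (i : Fin r) : CoverCylinder n → ℝ :=
  Quot.lift (Sum.elim (fun p => if p.1 = i then (p.2.2 : ℝ) else 0) fun _ => 0)
    (by rintro _ _ ⟨i, z, rfl, rfl⟩; simp)

/-- The projection to the core circle. -/
noncomputable def proj : CoverCylinder n → Circle :=
  Quot.lift (Sum.elim (fun p => p.2.1 ^ n p.1) id) (by rintro _ _ ⟨i, z, rfl, rfl⟩; rfl)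

open Classical in
/-- The coordinates of a point outside the core circle. -/
noncomputable def coord : CoverCylinder n → Option (Fin r × Circle × unitInterval) :=
  Quot.lift (Sum.elim (fun p => if p.2.2 = 0 then none else some p) fun _ => none)
    (by rintro _ _ ⟨i, z, rfl, rfl⟩; simp)

theorem continuous_height : Continuous (height (n := n)) :=
  continuous_quot_lift _ (Continuous.sumElim (by fun_prop) continuous_const)

theorem continuous_sheetHeight (i : Fin r) : Continuous (sheetHeight (n := n) i) := by
  refine continuous_quot_lift _ (Continuous.sumElim ?_ continuous_const)
  refine continuous_prod_of_discrete_left.mpr fun j => ?_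
  by_cases h : j = i
  · simp only [h, if_true]
    fun_prop
  · simp only [h, if_false]
    exact continuous_const

theorem continuous_proj : Continuous (proj (n := n)) := by
  refine continuous_quot_lift _ (Continuous.sumElim ?_ continuous_id)
  exact continuous_prod_of_discrete_left.mpr fun j => continuous_fst.pow (n j)

@[simp] theorem height_point (i : Fin r) (z : Circle) (t : unitInterval) :
    height (point n i z t) = t := rfl

@[simp] theorem height_corePoint (z : Circle) : height (corePoint n z) = 0 := rfl

@[simp] theorem proj_point (i : Fin r) (z : Circle) (t : unitInterval) :
    proj (point n i z t) = z ^ n i := rfl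

@[simp] theorem proj_corePoint (z : Circle) : proj (corePoint n z) = z := rfl

@[simp] theorem sheetHeight_point_self (i : Fin r) (z : Circle) (t : unitInterval) :
    sheetHeight i (point n i z t) = t :=
  if_pos rfl

theorem sheetHeight_point_of_ne {i j : Fin r} (h : j ≠ i) (z : Circle) (t : unitInterval) :
    sheetHeight i (point n j z t) = 0 :=
  if_neg h

theorem point_inj {i j : Fin r} {z w : Circle} {t s : unitInterval} (ht : t ≠ 0) (hs : s ≠ 0)
    (h : point n i z t = point n j w s) : i = j ∧ z = w ∧ t = s := by
  have h1 : coord (point n i z t) = some (i, z, t) := if_neg ht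
  have h2 : coord (point n j w s) = some (j, w, s) := if_neg hs
  rw [h, h2] at h1
  simpa [eq_comm] using h1

theorem exists_eq_point_of_height_ne_zero {y : CoverCylinder n} (h : height y ≠ 0) :
    ∃ i z t, y = point n i z t := by
  rcases eq_corePoint_or_eq_point y with ⟨z, rfl⟩ | h'
  · exact (h rfl).elim
  · exact h'

theorem height_of_mem_rim {i : Fin r} {y : CoverCylinder n} (h : y ∈ rim n i) : height y = 1 := by
  obtain ⟨z, rfl⟩ := h
  rfl

theorem height_of_mem_core {y : CoverCylinder n} (h : y ∈ core n) : height y = 0 := by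
  obtain ⟨z, rfl⟩ := h
  rfl

theorem mem_core_of_height {y : CoverCylinder n} (h : height y = 0) : y ∈ core n := by
  rcases eq_corePoint_or_eq_point y with ⟨z, rfl⟩ | ⟨i, z, t, rfl⟩
  · exact ⟨z, rfl⟩
  · have : t = 0 := Subtype.ext h
    rw [this, point_zero]
    exact ⟨_, rfl⟩

end CoverCylinder

/-! ### Cuts in regular neighborhoods -/

namespace RegularNbhd

open CoverCylinder

variable {X : Type*} [TopologicalSpace X] {C : Set X} (N : RegularNbhd C)

/-- The frontier of the neighborhood consists of the boundary circles, at height 1. An open set of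
the cylinder that avoids them is mapped into the interior and hence stays open in `X`. -/
theorem isOpen_image {U : Set (CoverCylinder N.mult)} (hU : IsOpen U)
    (h : ∀ y ∈ U, height y ≠ 1) : IsOpen (N.emb '' U) := by
  obtain ⟨V, hV, rfl⟩ := N.isEmbedding.isInducing.isOpen_iff.mp hU
  have : N.emb '' (N.emb ⁻¹' V) = V ∩ interior (Set.range N.emb) := by
    rw [Set.image_preimage_eq_inter_range]
    refine Set.Subset.antisymm ?_ (Set.inter_subset_inter_right _ interior_subset)
    rintro _ ⟨hy, y, rfl⟩
    refine ⟨hy, ?_⟩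
    by_contra hn
    have hf : N.emb y ∈ frontier (Set.range N.emb) := ⟨subset_closure ⟨y, rfl⟩, hn⟩
    rw [N.frontier_eq] at hf
    obtain ⟨i, y', hy', he⟩ := Set.mem_iUnion.mp hf
    rw [N.isEmbedding.injective he] at hy'
    exact h y hy (height_of_mem_rim hy')
  rw [this]
  exact hV.inter isOpen_interior

theorem isClosed_range [T2Space X] : IsClosed (Set.range N.emb) :=
  (isCompact_range N.isEmbedding.continuous).isClosed

theorem emb_mem_iff (y : CoverCylinder N.mult) : N.emb y ∈ C ↔ height y = 0 := by
  have h : N.emb y ∈ N.emb '' core N.mult ↔ height y = 0 := by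
    rw [N.isEmbedding.injective.mem_set_image]
    exact ⟨height_of_mem_core, mem_core_of_height⟩
  rwa [N.image_core] at h

theorem mem_interior_range {x : X} (hx : x ∈ C) : x ∈ interior (Set.range N.emb) := by
  have h : IsOpen (N.emb '' {y | height y < 1}) :=
    N.isOpen_image (isOpen_lt continuous_height continuous_const) fun y hy => ne_of_lt hy
  refine interior_maximal (Set.image_subset_range _ _) h ?_
  rw [← N.image_core] at hx
  obtain ⟨y, hy, rfl⟩ := hx
  refine ⟨y, ?_, rfl⟩
  change height y < 1
  rw [height_of_mem_core hy]
  exact one_pos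

variable {A Q : Set (CoverCylinder N.mult)}

theorem potAt_cut_of_notMem_range [T2Space X] {x : X} (hx : x ∉ Set.range N.emb) :
    PotAt (cutCochain (N.emb '' A) (N.emb '' Q)) 0 x :=
  potAt_cutCochain_zero_of_subset (mem_of_superset (N.isClosed_range.isOpen_compl.mem_nhds hx)
    fun _ hy hyA => (hy (Set.image_subset_range _ _ hyA)).elim)

theorem potAt_cut_zero_of_subset {y : CoverCylinder N.mult} {U : Set (CoverCylinder N.mult)}
    (hU : IsOpen U) (hy : y ∈ U) (h : ∀ y' ∈ U, y' ∈ A → y' ∈ Q) :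
    PotAt (cutCochain (N.emb '' A) (N.emb '' Q)) 0 (N.emb y) := by
  refine potAt_cutCochain_zero_of_subset ?_
  have := hU.mem_nhds hy
  rw [N.isEmbedding.nhds_eq_comap, mem_comap'] at this
  filter_upwards [this] with a ha
  rintro ⟨y', hy', rfl⟩
  exact ⟨y', h y' (ha rfl) hy', rfl⟩

theorem potAt_cut_zero_of_disjoint {y : CoverCylinder N.mult} {U : Set (CoverCylinder N.mult)}
    (hU : IsOpen U) (hy : y ∈ U) (h : ∀ y' ∈ U, y' ∈ A → y' ∉ Q) :
    PotAt (cutCochain (N.emb '' A) (N.emb '' Q)) 0 (N.emb y) := by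
  refine potAt_cutCochain_zero_of_disjoint ?_
  have := hU.mem_nhds hy
  rw [N.isEmbedding.nhds_eq_comap, mem_comap'] at this
  filter_upwards [this] with a ha
  rintro ⟨y', hy', rfl⟩
  rw [N.isEmbedding.injective.mem_set_image]
  exact h y' (ha rfl) hy'

/-- The cut along the circle at height `1 / 2` of a sheet of a regular neighborhood. -/
theorem exists_cut_of_sheet [T2Space X] (i : Fin N.r) :
    ∃ g : X → X → ZMod 2, (∀ x, CocycleAt g x) ∧
      (∀ x, x ∉ N.emb '' {y | sheetHeight i y = 1 / 2} → PotAt g 0 x) ∧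
      ∀ F, (∀ x, PotAt g F x) →
        F (N.emb (point _ i 1 0)) + F (N.emb (point _ i 1 1)) = 1 := by
  -- `A` removes the boundary circles, where the image need not be open. Nothing is lost, since the
  -- cut lies at height `1 / 2`.
  let A : Set (CoverCylinder N.mult) := {y | height y < 1}
  let Q : Set (CoverCylinder N.mult) := {y | 1 / 2 ≤ sheetHeight i y}
  let g := cutCochain (N.emb '' A) (N.emb '' Q)
  have hA : IsOpen (N.emb '' A) :=
    N.isOpen_image (isOpen_lt continuous_height continuous_const) fun y hy => ne_of_lt hy
  have hzero (x : X) (hx : x ∉ N.emb '' {y | sheetHeight i y = 1 / 2}) : PotAt g 0 x := by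
    by_cases hxr : x ∈ Set.range N.emb
    · obtain ⟨y, rfl⟩ := hxr
      rcases lt_trichotomy (sheetHeight i y) (1 / 2) with h | h | h
      · exact N.potAt_cut_zero_of_disjoint
          (isOpen_lt (continuous_sheetHeight i) continuous_const) h
          fun y' hy' _ => not_le_of_gt (show sheetHeight i y' < 1 / 2 from hy')
      · exact (hx ⟨y, h, rfl⟩).elim
      · exact N.potAt_cut_zero_of_subset
          (isOpen_lt continuous_const (continuous_sheetHeight i)) h
          fun y' hy' _ => le_of_lt (show 1 / 2 < sheetHeight i y' from hy')
    · exact N.potAt_cut_of_notMem_range hxr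
  refine ⟨g, fun x => ?_, hzero, fun F hF => ?_⟩
  · by_cases hx : x ∈ N.emb '' {y | sheetHeight i y = 1 / 2}
    · obtain ⟨y, hy, rfl⟩ := hx
      have hy : sheetHeight i y = 1 / 2 := hy
      refine ⟨_, potAt_cutCochain_of_mem_nhds (hA.mem_nhds ⟨y, ?_, rfl⟩)⟩
      change height y < 1
      rcases eq_corePoint_or_eq_point y with ⟨z, rfl⟩ | ⟨j, z, t, rfl⟩
      · exact one_pos
      · by_cases hij : j = i
        · subst hij
          rw [sheetHeight_point_self] at hy
          rw [height_point, hy]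
          norm_num
        · rw [sheetHeight_point_of_ne hij] at hy
          norm_num at hy
    · exact ⟨0, hzero x hx⟩
  · let γ : unitInterval → X := fun t => N.emb (point _ i 1 t)
    have hγ : Continuous γ := N.isEmbedding.continuous.comp
      ((continuous_point i).comp (Continuous.prodMk_right 1))
    let S : Set unitInterval := {t | 1 / 2 ≤ (t : ℝ)}
    have hg : (fun a b => g (γ a) (γ b)) =
        cutCochain {t : unitInterval | (t : ℝ) < 1} S := by
      funext a b
      simp only [g, γ, cutCochain_image N.isEmbedding.injective]
      exact cutCochain_congr Iff.rfl Iff.rfl (by simp [Q, S]) (by simp [Q, S])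
    have hpot (t : unitInterval) : PotAt (fun a b => g (γ a) (γ b)) (S.indicator 1) t := by
      rw [hg]
      by_cases ht : (t : ℝ) < 1
      · exact potAt_cutCochain_of_mem_nhds
          ((isOpen_lt continuous_subtype_val continuous_const).mem_nhds ht)
      -- The top end `t = 1` is outside `A`, but near it the indicator of `S` is constantly 1, so
      -- its coboundary and the cochain both vanish.
      · have ht2 : (1 / 2 : ℝ) < t := by linarith
        refine potAt_of_forall
          ((isOpen_lt continuous_const continuous_subtype_val).mem_nhds ht2) fun a ha b hb => ?_
        have ha : a ∈ S := le_of_lt (show (1 / 2 : ℝ) < a from ha)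
        have hb : b ∈ S := le_of_lt (show (1 / 2 : ℝ) < b from hb)
        unfold cutCochain
        split_ifs
        · rfl
        · rw [Set.indicator_of_mem ha, Set.indicator_of_mem hb]
          exact (CharTwo.add_self_eq_zero _).symm
    have := isPreconnected_univ.eq_of_eventually_eq
      (f := fun t => F (γ t) + S.indicator 1 t)
      (fun t _ => ((hF (γ t)).comp hγ.continuousAt).eventually_add_eq (hpot t))
      (Set.mem_univ 0) (Set.mem_univ 1)
    have h0 : (0 : unitInterval) ∉ S := by
      change ¬ (1 / 2 : ℝ) ≤ 0
      norm_num
    have h1 : (1 : unitInterval) ∈ S := by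
      change (1 / 2 : ℝ) ≤ 1
      norm_num
    simp only [Set.indicator_of_notMem h0, Set.indicator_of_mem h1, add_zero, Pi.one_apply,
      γ] at this
    rw [this, add_comm, ← add_assoc, CharTwo.add_self_eq_zero, zero_add]

end RegularNbhd

/-! ### Cuts across the core circle -/

section CoreCut

open CoverCylinder

theorem mildAt_of_finite {X : Type*} [TopologicalSpace X] [T1Space X] {g : X → X → ZMod 2}
    {s : Set X} (hs : s.Finite) (h : ∀ x ∉ s, CocycleAt g x) (x : X) : MildAt g x := by
  have : (s \ {x})ᶜ ∈ 𝓝 x := (hs.subset Set.sdiff_subset).isClosed.isOpen_compl.mem_nhds (by simp)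
  refine eventually_nhdsWithin_iff.mpr (mem_of_superset this fun y hy hyx => ?_)
  exact h y fun hys => hy ⟨hys, hyx⟩

/-- The middle of the unit interval. -/
noncomputable def midpointUnitInterval : unitInterval :=
  ⟨1 / 2, by norm_num, by norm_num⟩

theorem midpointUnitInterval_ne_zero : midpointUnitInterval ≠ 0 := by
  intro h
  have := congrArg Subtype.val h
  norm_num [midpointUnitInterval] at this

theorem Circle.re_exp (θ : ℝ) : ((Circle.exp θ : Circle) : ℂ).re = Real.cos θ := by
  rw [Circle.coe_exp, Complex.exp_ofReal_mul_I_re]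

theorem Circle.im_exp (θ : ℝ) : ((Circle.exp θ : Circle) : ℂ).im = Real.sin θ := by
  rw [Circle.coe_exp, Complex.exp_ofReal_mul_I_im]

theorem Circle.eq_one_of_im_eq_zero {z : Circle} (h : (z : ℂ).im = 0) (h' : 0 < (z : ℂ).re) :
    z = 1 := by
  have h1 : (z : ℂ).re * (z : ℂ).re + (z : ℂ).im * (z : ℂ).im = 1 := by
    rw [← Complex.normSq_apply, Circle.normSq_coe]
  refine Circle.ext (Complex.ext ?_ (by simpa using h))
  rw [h] at h1
  simp only [Circle.coe_one, Complex.one_re]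
  nlinarith

/-- On the real line, the cut at the multiples of `2 * π` is not the coboundary of a
`2 * π`-periodic function. -/
theorem not_potAt_cut_of_periodic {F : ℝ → ZMod 2} (hF : ∀ θ, F (θ + 2 * Real.pi) = F θ) :
    ¬ ∀ θ, PotAt (cutCochain {θ | 0 < Real.cos θ} {θ | 0 ≤ Real.sin θ}) F θ := by
  intro h
  -- Inside one period the cochain vanishes near the diagonal: the other zero `π` of the sine is
  -- excluded by the condition on the cosine.
  have hconst : ∀ a ∈ Set.Ioo 0 (2 * Real.pi), ∀ b ∈ Set.Ioo 0 (2 * Real.pi), F a = F b := by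
    intro a ha b hb
    refine isPreconnected_Ioo.eq_of_eventually_eq (fun θ hθ => ?_) ha hb
    have h0 : PotAt (cutCochain {θ | 0 < Real.cos θ} {θ | 0 ≤ Real.sin θ}) 0 θ := by
      rcases lt_trichotomy (Real.sin θ) 0 with hs | hs | hs
      · exact potAt_cutCochain_zero_of_disjoint
          (mem_of_superset ((isOpen_lt Real.continuous_sin continuous_const).mem_nhds hs)
            fun y hy _ => not_le_of_gt (show Real.sin y < 0 from hy))
      · have hc : Real.cos θ < 0 := by
          obtain ⟨n, rfl⟩ := Real.sin_eq_zero_iff.mp hs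
          have h1 : (0 : ℝ) < n := pos_of_mul_pos_left hθ.1 Real.pi_pos.le
          have h2 : (n : ℝ) < 2 := lt_of_mul_lt_mul_right hθ.2 Real.pi_pos.le
          have h3 : n = 1 := by
            have h1 : 0 < n := by exact_mod_cast h1
            have h2 : n < 2 := by exact_mod_cast h2
            omega
          simp [h3]
        exact potAt_cutCochain_zero_of_disjoint (mem_of_superset
          ((isOpen_lt Real.continuous_cos continuous_const).mem_nhds hc)
          fun y hy hy' => (lt_asymm (show Real.cos y < 0 from hy) hy').elim)
      · exact potAt_cutCochain_zero_of_subset (mem_of_superset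
          ((isOpen_lt continuous_const Real.continuous_sin).mem_nhds hs)
          fun y hy _ => le_of_lt (show 0 < Real.sin y from hy))
    simpa using h0.eventually_add_eq (h θ)
  obtain ⟨U, hU, h0, hUp⟩ := potAt_iff.mp
    (((potAt_cutCochain_of_mem_nhds (Q := {θ | 0 ≤ Real.sin θ})
      ((isOpen_lt continuous_const Real.continuous_cos).mem_nhds
        (show (0 : ℝ) ∈ {θ | 0 < Real.cos θ} by simp))).add (h 0)))
  rw [cochain_add_self] at hUp
  have hneg : Tendsto (fun θ : ℝ => -θ) (𝓝 0) (𝓝 0) := by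
    simpa using continuous_neg.tendsto (0 : ℝ)
  have hUm : ∀ᶠ θ in 𝓝 (0 : ℝ), θ ∈ U := hU.mem_nhds h0
  obtain ⟨η, ⟨⟨h1, h2⟩, h3⟩, h4⟩ := ((hUm.and (hneg.eventually hUm)).and (gt_mem_nhds Real.pi_pos)).filter_mono
      nhdsWithin_le_nhds |>.and (self_mem_nhdsWithin (s := Set.Ioi (0 : ℝ))) |>.exists
  have h4 : 0 < η := h4
  -- A shift by one period brings `-η` into the interval that contains `η`, although the cut at 0
  -- separates the two points.
  have h5 : F (-η) = F η := by
    rw [← hF (-η)]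
    exact hconst _ ⟨by linarith, by linarith⟩ _ ⟨h4, by linarith⟩
  have hs : 0 < Real.sin η := Real.sin_pos_of_pos_of_lt_pi h4 h3
  have := hUp η h1 (-η) h2
  simp only [Pi.zero_apply, Pi.add_apply, h5] at this
  simp [hs, hs.le, add_assoc, CharTwo.add_self_eq_zero] at this

namespace RegularNbhd

variable {X : Type*} [TopologicalSpace X] {C : Set X} (N : RegularNbhd C)

/-- The end points of the cut across the core of a regular neighborhood. -/
noncomputable def cutPoint (p : Σ i : Fin N.r, rootsOfUnity (N.mult i) Circle) : X :=
  N.emb (point _ p.1 (p.2 : Circleˣ) midpointUnitInterval)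

theorem natCard_rootsOfUnity (i : Fin N.r) :
    Nat.card (rootsOfUnity (N.mult i) Circle) = N.mult i := by
  have : NeZero (N.mult i) := ⟨(N.mult_pos i).ne'⟩
  exact HasEnoughRootsOfUnity.natCard_rootsOfUnity _ _

theorem finite_rootsOfUnity (i : Fin N.r) : Finite (rootsOfUnity (N.mult i) Circle) :=
  Nat.finite_of_card_ne_zero ((N.natCard_rootsOfUnity i).trans_ne (N.mult_pos i).ne')

theorem cutPoint_injective : Function.Injective N.cutPoint := by
  rintro ⟨i, z⟩ ⟨j, w⟩ h
  obtain ⟨rfl, h2, -⟩ := point_inj midpointUnitInterval_ne_zero midpointUnitInterval_ne_zero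
    (N.isEmbedding.injective h)
  have : z = w := Subtype.ext (Units.ext h2)
  rw [this]

/-- The cut across the core of a regular neighborhood, at one point of the core and half the way
along all sheets. -/
theorem exists_cut_across_core [T2Space X] :
    ∃ g : X → X → ZMod 2, (∀ x, x ∉ Set.range N.emb → PotAt g 0 x) ∧
      (∀ x, x ∉ Set.range N.cutPoint → CocycleAt g x) ∧
      (∀ p, ¬ RemovableAt g (N.cutPoint p)) ∧ ¬ ∃ F, ∀ x ∈ C, PotAt g F x := by
  -- The cut is the part of the fibre of `proj` over the point 1 of the core below height `1 / 2`.
  -- The inequality on the real part excludes the fibre over `-1`. In sheet `i` the ends lie over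
  -- the `mult i` roots of unity.
  let A : Set (CoverCylinder N.mult) := {y | 0 < (proj y : ℂ).re ∧ height y < 1 / 2}
  let Q : Set (CoverCylinder N.mult) := {y | 0 ≤ (proj y : ℂ).im}
  have hre : Continuous fun y : CoverCylinder N.mult => (proj y : ℂ).re :=
    Complex.continuous_re.comp (continuous_subtype_val.comp continuous_proj)
  have him : Continuous fun y : CoverCylinder N.mult => (proj y : ℂ).im :=
    Complex.continuous_im.comp (continuous_subtype_val.comp continuous_proj)
  have hA : IsOpen (N.emb '' A) := by
    refine N.isOpen_image ((isOpen_lt continuous_const hre).inter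
      (isOpen_lt continuous_height continuous_const)) fun y hy h => ?_
    have := hy.2
    rw [show height y = 1 from h] at this
    norm_num at this
  refine ⟨cutCochain (N.emb '' A) (N.emb '' Q), fun x hx => N.potAt_cut_of_notMem_range hx,
    fun x hx => ?_, ?_, ?_⟩
  · by_cases hxr : x ∈ Set.range N.emb
    swap
    · exact ⟨0, N.potAt_cut_of_notMem_range hxr⟩
    obtain ⟨y, rfl⟩ := hxr
    by_cases hyA : y ∈ A
    · exact ⟨_, potAt_cutCochain_of_mem_nhds (hA.mem_nhds ⟨y, hyA, rfl⟩)⟩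
    refine ⟨0, ?_⟩
    rcases lt_trichotomy (proj y : ℂ).im 0 with h | h | h
    · exact N.potAt_cut_zero_of_disjoint (isOpen_lt him continuous_const) h
        fun y' hy' _ => not_le_of_gt (show (proj y' : ℂ).im < 0 from hy')
    · by_cases h1 : (proj y : ℂ).re < 0
      · exact N.potAt_cut_zero_of_subset (isOpen_lt hre continuous_const) h1
          fun y' hy' hyA' => (lt_asymm (show (proj y' : ℂ).re < 0 from hy') hyA'.1).elim
      have h0 : (proj y : ℂ).re ≠ 0 := by
        intro h0
        have := Circle.coe_ne_zero (proj y)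
        exact this (Complex.ext h0 h)
      have h1 : 0 < (proj y : ℂ).re := lt_of_le_of_ne (not_lt.mp h1) h0.symm
      have h2 : proj y = 1 := Circle.eq_one_of_im_eq_zero h h1
      have h3 : 1 / 2 ≤ height y := not_lt.mp fun h3 => hyA ⟨h1, h3⟩
      obtain ⟨i, z, t, rfl⟩ := exists_eq_point_of_height_ne_zero (y := y) (by linarith)
      rw [proj_point] at h2
      have h4 : 1 / 2 < height (point N.mult i z t) := by
        refine lt_of_le_of_ne h3 fun h4 => hx ⟨⟨i, ⟨Units.mk z z⁻¹ (by simp) (by simp), ?_⟩⟩, ?_⟩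
        · rw [mem_rootsOfUnity]
          exact Units.ext h2
        · have : t = midpointUnitInterval := Subtype.ext h4.symm
          rw [this]
          rfl
      exact N.potAt_cut_zero_of_subset (isOpen_lt continuous_const continuous_height) h4
        fun y' hy' hyA' => (lt_asymm (show 1 / 2 < height y' from hy') hyA'.2).elim
    · exact N.potAt_cut_zero_of_subset (isOpen_lt continuous_const him) h
        fun y' hy' _ => le_of_lt (show 0 < (proj y' : ℂ).im from hy')
  · rintro ⟨i, z⟩
    have hm : (N.mult i : ℝ) ≠ 0 := Nat.cast_ne_zero.mpr (N.mult_pos i).ne'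
    have hz : ((z : Circleˣ) : Circle) ^ N.mult i = 1 := by
      have := (mem_rootsOfUnity _ _).mp z.2
      exact congrArg Units.val this
    -- Dividing the angle by `mult i` undoes the covering, so the projection to the core is
    -- `Circle.exp v.2` and the local picture does not depend on the degree.
    let J : ℝ × ℝ → X := fun v => N.emb (point _ i ((z : Circleˣ) * Circle.exp (v.2 / N.mult i))
      (Set.projIcc 0 1 zero_le_one (1 / 2 + v.1)))
    have hJ : Continuous J := by
      refine N.isEmbedding.continuous.comp ((continuous_point i).comp (.prodMk ?_ ?_))
      · exact continuous_const.mul (Circle.exp.continuous.comp (by fun_prop))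
      · exact (continuous_projIcc (h := zero_le_one)).comp (by fun_prop)
    have hproj (s : ℝ) (hs : |s| < 1 / 2) :
        ((Set.projIcc (0 : ℝ) 1 zero_le_one (1 / 2 + s) : unitInterval) : ℝ) = 1 / 2 + s := by
      rw [abs_lt] at hs
      rw [Set.projIcc_of_mem zero_le_one ⟨by linarith, by linarith⟩]
    have hball : Metric.ball (0 : ℝ × ℝ) (1 / 2) ∈ 𝓝 (0 : ℝ × ℝ) :=
      Metric.ball_mem_nhds _ (by norm_num)
    have hb (v : ℝ × ℝ) (hv : v ∈ Metric.ball (0 : ℝ × ℝ) (1 / 2)) :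
        |v.1| < 1 / 2 ∧ |v.2| < 1 / 2 := by
      rwa [mem_ball_zero_iff, Prod.norm_def, max_lt_iff] at hv
    have h0 : J 0 = N.cutPoint ⟨i, z⟩ := by
      have : (Set.projIcc 0 1 zero_le_one (1 / 2 + 0) : unitInterval) = midpointUnitInterval :=
        Subtype.ext (by rw [hproj 0 (by norm_num)]; simp [midpointUnitInterval])
      simp only [J, cutPoint, Prod.snd_zero, zero_div, Circle.exp_zero, mul_one, Prod.fst_zero,
        this]
    rw [← h0]
    refine not_removableAt_of_model hJ ?_ ?_
    · filter_upwards [hball] with v hv h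
      obtain ⟨h1, h2⟩ := hb v hv
      rw [h0] at h
      have h3 : (Set.projIcc 0 1 zero_le_one (1 / 2 + v.1) : unitInterval) ≠ 0 := by
        intro h3
        have := congrArg Subtype.val h3
        rw [hproj _ h1] at this
        have := (abs_lt.mp h1).1
        simp at *
        linarith
      obtain ⟨-, h4, h5⟩ := point_inj h3 midpointUnitInterval_ne_zero
        (N.isEmbedding.injective h)
      refine Prod.ext ?_ ?_
      · have := congrArg Subtype.val h5
        rw [hproj _ h1] at this
        simpa [midpointUnitInterval] using this
      · have h6 : Circle.exp (v.2 / N.mult i) = 1 := by simpa using h4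
        have h7 : |v.2 / N.mult i| ≤ 1 / 2 := by
          rw [abs_div, Nat.abs_cast]
          refine (div_le_self (abs_nonneg _) ?_).trans h2.le
          exact_mod_cast N.mult_pos i
        have h8 := Circle.exp_injOn_Icc (a := -(1 / 2)) (b := 1 / 2)
          (by linarith [Real.pi_gt_three]) (abs_le.mp h7) ⟨by norm_num, by norm_num⟩
          (h6.trans Circle.exp_zero.symm)
        simpa [hm] using h8
    · filter_upwards [prod_mem_prod hball hball] with p hp
      have hv (v : ℝ × ℝ) :
          proj (point N.mult i ((z : Circleˣ) * Circle.exp (v.2 / N.mult i))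
            (Set.projIcc 0 1 zero_le_one (1 / 2 + v.1))) = Circle.exp v.2 := by
        rw [proj_point, mul_pow, hz, one_mul, ← Circle.exp_natCast_mul, mul_div_cancel₀ _ hm]
      have hvA (v : ℝ × ℝ) (hv' : v ∈ Metric.ball (0 : ℝ × ℝ) (1 / 2)) :
          point N.mult i ((z : Circleˣ) * Circle.exp (v.2 / N.mult i))
            (Set.projIcc 0 1 zero_le_one (1 / 2 + v.1)) ∈ A ↔ v ∈ {v : ℝ × ℝ | v.1 < 0} := by
        obtain ⟨h1, h2⟩ := hb v hv'
        have hcos : 0 < Real.cos v.2 := Real.cos_pos_of_mem_Ioo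
          ⟨by linarith [Real.pi_gt_three, (abs_lt.mp h2).1],
            by linarith [Real.pi_gt_three, (abs_lt.mp h2).2]⟩
        change _ ∧ _ ↔ v.1 < 0
        rw [hv, Circle.re_exp, height_point, hproj _ h1]
        exact ⟨fun h => by linarith [h.2], fun h => ⟨hcos, by linarith⟩⟩
      have hvQ (v : ℝ × ℝ) (hv' : v ∈ Metric.ball (0 : ℝ × ℝ) (1 / 2)) :
          point N.mult i ((z : Circleˣ) * Circle.exp (v.2 / N.mult i))
            (Set.projIcc 0 1 zero_le_one (1 / 2 + v.1)) ∈ Q ↔ v ∈ {v : ℝ × ℝ | 0 ≤ v.2} := by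
        obtain ⟨-, h2⟩ := hb v hv'
        change 0 ≤ (proj (point N.mult i ((z : Circleˣ) * Circle.exp (v.2 / N.mult i))
          (Set.projIcc 0 1 zero_le_one (1 / 2 + v.1))) : ℂ).im ↔ 0 ≤ v.2
        rw [hv, Circle.im_exp]
        constructor
        · intro h
          by_contra hneg
          have := Real.sin_neg_of_neg_of_neg_pi_lt (not_le.mp hneg)
            (by linarith [Real.pi_gt_three, (abs_lt.mp h2).1])
          linarith
        · intro h
          exact Real.sin_nonneg_of_nonneg_of_le_pi h
            (by linarith [Real.pi_gt_three, (abs_lt.mp h2).2])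
      simp only [J]
      rw [cutCochain_image N.isEmbedding.injective]
      exact cutCochain_congr (hvA _ hp.1) (hvA _ hp.2) (hvQ _ hp.1) (hvQ _ hp.2)
  · rintro ⟨F, hF⟩
    let γ : ℝ → X := fun θ => N.emb (corePoint _ (Circle.exp θ))
    have hγ : Continuous γ := N.isEmbedding.continuous.comp
      (continuous_corePoint.comp Circle.exp.continuous)
    refine not_potAt_cut_of_periodic (F := F ∘ γ) (fun θ => ?_) fun θ => ?_
    · simp [γ, Circle.exp_add]
    · have := (hF (γ θ) ((N.emb_mem_iff _).mpr rfl)).comp hγ.continuousAt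
      have hg : (fun a b => cutCochain (N.emb '' A) (N.emb '' Q) (γ a) (γ b)) =
          cutCochain {θ | 0 < Real.cos θ} {θ | 0 ≤ Real.sin θ} := by
        funext a b
        rw [cutCochain_image N.isEmbedding.injective]
        exact cutCochain_congr (by simp [A]) (by simp [A]) (by simp [Q]) (by simp [Q])
      rwa [hg] at this

end RegularNbhd

end CoreCut

/-! ### Balanced weights on bicolored graphs -/

section Balanced

/-- In a finite bicolored graph in which all edges are bridges and have label 1 or 2, and in which
no edge of label 1 ends in a terminal white vertex, there is a nonzero weight modulo 2 on the black
vertices such that at each white vertex the sum of the weights of the adjacent black vertices,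
multiplied by the labels, is zero. -/
theorem exists_balanced_weight {W B E : Type*} [Finite B] [Nonempty B] [Fintype E] [DecidableEq W]
    (white : E → W) (black : E → B) (label : E → ℕ) (hlab : ∀ e, label e = 1 ∨ label e = 2)
    (hbridge : ∀ e, ∃ (fW : W → ZMod 2) (fB : B → ZMod 2),
      fW (white e) + fB (black e) = 1 ∧ ∀ e' ≠ e, fW (white e') + fB (black e') = 0)
    (hterm : ∀ e, label e = 1 → ∃ e' ≠ e, white e' = white e) :
    ∃ ε : B → ZMod 2, ε ≠ 0 ∧
      ∀ w, ∑ e, (if white e = w then (label e : ZMod 2) else 0) * ε (black e) = 0 := by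
  classical
  -- A step leaves `b` along an edge of label 1, but may arrive along an edge of any label. By
  -- minimality of its cardinality, `reach b₀` is the reachable set of each of its members.
  let step : B → B → Prop := fun b b' =>
    ∃ e e', black e = b ∧ black e' = b' ∧ white e = white e' ∧ label e = 1
  let reach : B → Set B := fun b => {b' | Relation.ReflTransGen step b b'}
  obtain ⟨b₀, hb₀⟩ := Finite.exists_min fun b => (reach b).ncard
  have hmono {b : B} (hb : b ∈ reach b₀) : reach b₀ = reach b := by
    refine (Set.eq_of_subset_of_ncard_le (fun c hc => ?_) (hb₀ b) (Set.toFinite _)).symm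
    exact Relation.ReflTransGen.trans hb hc
  set C := reach b₀ with hC
  have hstep {e e' : E} (he : label e = 1) (heC : black e ∈ C) (hw : white e' = white e) :
      black e' ∈ C :=
    Relation.ReflTransGen.tail heC ⟨e, e', rfl, rfl, hw.symm, he⟩
  -- An edge `e'` of label 2 at this white vertex would be entered but never left by a step. The way
  -- back from `black e'` to `black e` then avoids crossing the bridge `e'`, and together with `e`
  -- it closes a cycle.
  have hlabel {e e' : E} (he : label e = 1) (heC : black e ∈ C) (hw : white e' = white e) :
      label e' = 1 := by
    refine (hlab e').resolve_right fun h2 => ?_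
    obtain ⟨fW, fB, h1, h0⟩ := hbridge e'
    have hne {e₁ : E} (h : label e₁ = 1) : e₁ ≠ e' := by
      rintro rfl
      omega
    have hreach : black e ∈ reach (black e') := hmono (hstep he heC hw) ▸ heC
    have key : fB (black e) = fB (black e') := by
      refine Relation.ReflTransGen.head_induction_on
        (motive := fun b _ => fB b = fB (black e') → fB (black e) = fB (black e')) hreach
        (fun h => h) ?_ rfl
      rintro _ _ ⟨e₁, e₂, rfl, rfl, hw₁, hl₁⟩ - ih h
      refine ih ?_
      -- If the walk arrives along `e'`, it is back at `black e'`, where the value of `fB` is known;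
      -- otherwise both edges of the step differ from the bridge and preserve `fB`.
      by_cases h12 : e₂ = e'
      · rw [h12]
      · have h3 := h0 e₁ (hne hl₁)
        have h4 := h0 e₂ h12
        rw [← hw₁, ← h3] at h4
        rw [add_left_cancel h4, h]
    have h3 := h0 e (hne he)
    rw [← hw, key, h1] at h3
    exact one_ne_zero h3
  let EC : Set E := {e | label e = 1 ∧ black e ∈ C}
  let WC : Set W := white '' EC
  have : Fintype C := Fintype.ofFinite _
  have : Fintype EC := Fintype.ofFinite _
  have hWfin : WC.Finite := EC.toFinite.image _
  have : Fintype WC := hWfin.fintype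
  have hb₀C : b₀ ∈ C := Relation.ReflTransGen.refl
  have hcard : Fintype.card WC * 2 ≤ Fintype.card EC := by
    have h2 (w : WC) : ∃ e e' : EC, e ≠ e' ∧ white e = w ∧ white e' = w := by
      obtain ⟨w, e, ⟨he, heC⟩, rfl⟩ := w
      obtain ⟨e', hne, hw⟩ := hterm e he
      exact ⟨⟨e, he, heC⟩, ⟨e', hlabel he heC hw, hstep he heC hw⟩,
        fun h => hne (congrArg Subtype.val h).symm, rfl, hw⟩
    choose e₁ e₂ hne h1 h2 using h2
    have hinj : Function.Injective fun p : WC × Bool => if p.2 then e₁ p.1 else e₂ p.1 := by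
      rintro ⟨w, b⟩ ⟨w', b'⟩ h
      have hw : w = w' := by
        have := congrArg (fun e : EC => white e) h
        cases b <;> cases b' <;> simpa [h1, h2, Subtype.ext_iff] using this
      subst hw
      cases b <;> cases b' <;> simp_all [(hne _).symm]
    simpa using Fintype.card_le_of_injective _ hinj
  -- The coboundary map of the subgraph. It is onto because the functions witnessing that `e` is a
  -- bridge map to the basis vector of `e`.
  let D : ((WC → ZMod 2) × (C → ZMod 2)) →ₗ[ZMod 2] (EC → ZMod 2) :=
    { toFun := fun p e => p.1 ⟨white e, e, e.2, rfl⟩ + p.2 ⟨black e, e.2.2⟩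
      map_add' := fun p q => by
        funext e
        exact add_add_add_comm _ _ _ _
      map_smul' := fun c p => by
        funext e
        exact (mul_add _ _ _).symm }
  have hD : Function.Surjective D := by
    rw [← LinearMap.range_eq_top, eq_top_iff, ← Pi.basisFun (ZMod 2) EC |>.span_eq,
      Submodule.span_le]
    rintro _ ⟨e, rfl⟩
    obtain ⟨fW, fB, h1, h0⟩ := hbridge e
    refine ⟨(fun w => fW w, fun b => fB b), ?_⟩
    funext e'
    change fW (white e') + fB (black e') = _
    rw [Pi.basisFun_apply]
    by_cases h : e' = e
    · subst h
      rw [h1, Pi.single_eq_same]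
    · rw [h0 e' fun h' => h (Subtype.ext h'), Pi.single_eq_of_ne h]
  -- The constant function 1 lies in the kernel, so the rank formula gives `|EC| < |WC| + |C|`.
  have hker : 0 < Module.finrank (ZMod 2) (LinearMap.ker D) := by
    refine Module.finrank_pos_iff_exists_ne_zero.mpr ⟨⟨(fun _ => 1, fun _ => 1), ?_⟩, fun h => ?_⟩
    · rw [LinearMap.mem_ker]
      funext e
      exact CharTwo.add_self_eq_zero (1 : ZMod 2)
    · have := congrFun (congrArg Prod.snd (congrArg Subtype.val h)) ⟨b₀, hb₀C⟩
      exact one_ne_zero this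
  have hrank := LinearMap.finrank_range_add_finrank_ker D
  rw [LinearMap.range_eq_top.mpr hD, finrank_top, Module.finrank_prod,
    Module.finrank_fintype_fun_eq_card, Module.finrank_fintype_fun_eq_card, Module.finrank_fintype_fun_eq_card] at hrank
  have hlt : Fintype.card WC < Fintype.card C := by omega
  -- One balance equation for each vertex of `WC`, to be solved by weights supported on `C`. At the
  -- remaining white vertices an edge from `C` has label 2 and contributes zero.
  let L : (B → ZMod 2) →ₗ[ZMod 2] (WC → ZMod 2) := LinearMap.pi fun w =>
    ∑ e, (if white e = w then (label e : ZMod 2) else 0) • LinearMap.proj (black e)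
  obtain ⟨ε, hε, hε0⟩ := Submodule.exists_mem_ne_zero_of_ne_bot
    (LinearMap.ker_ne_bot_of_finrank_lt
      (f := L.comp (Function.ExtendByZero.linearMap (ZMod 2) (Subtype.val : C → B))) (by
        rw [Module.finrank_fintype_fun_eq_card, Module.finrank_fintype_fun_eq_card]
        exact hlt))
  refine ⟨Function.extend Subtype.val ε 0, fun h => hε0 ?_, fun w => ?_⟩
  · funext b
    have := congrFun h b
    rwa [Subtype.val_injective.extend_apply] at this
  · by_cases hw : w ∈ WC
    · have := congrFun (LinearMap.mem_ker.mp hε) ⟨w, hw⟩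
      simp only [L, LinearMap.comp_apply, LinearMap.pi_apply, LinearMap.sum_apply,
        LinearMap.smul_apply, LinearMap.proj_apply, smul_eq_mul] at this
      exact this
    · refine Finset.sum_eq_zero fun e _ => ?_
      split_ifs with hew
      · by_cases heC : black e ∈ C
        · have : label e = 2 := (hlab e).resolve_left fun h1 => hw ⟨e, ⟨h1, heC⟩, hew⟩
          rw [this]
          have : ((2 : ℕ) : ZMod 2) = 0 := rfl
          rw [this, zero_mul]
        · rw [Function.extend_apply' _ _ _ (by rintro ⟨b, hb⟩; exact heC (hb ▸ b.2))]
          simp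
      · simp

end Balanced

/-! ### The graph of a 2-stratifold -/

namespace RegularNbhdSystem

open CoverCylinder

section Basic

variable {X : Type*} [TopologicalSpace X] {X₁ : Set X} (N : RegularNbhdSystem X₁)

theorem componentSet_subset_range (c : ConnectedComponents X₁) :
    componentSet c ⊆ Set.range (N.nbhd c).emb :=
  fun _ hx => interior_subset ((N.nbhd c).mem_interior_range hx)

theorem eq_of_emb_mem_range {c c' : ConnectedComponents X₁} {y : CoverCylinder (N.nbhd c).mult}
    (h : (N.nbhd c).emb y ∈ Set.range (N.nbhd c').emb) : c = c' := by
  by_contra hne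
  exact Set.disjoint_left.mp (N.disjoint hne) ⟨y, rfl⟩ h

theorem exists_mem_componentSet {x : X} (hx : x ∈ X₁) : ∃ c, x ∈ componentSet (A := X₁) c :=
  ⟨ConnectedComponents.mk ⟨x, hx⟩, ⟨x, hx⟩, rfl, rfl⟩

theorem emb_mem_iff (c : ConnectedComponents X₁) (y : CoverCylinder (N.nbhd c).mult) :
    (N.nbhd c).emb y ∈ X₁ ↔ height y = 0 := by
  rw [← (N.nbhd c).emb_mem_iff]
  constructor
  · intro h
    obtain ⟨c', hc'⟩ := exists_mem_componentSet h
    obtain rfl := N.eq_of_emb_mem_range (N.componentSet_subset_range c' hc')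
    exact hc'
  · rintro ⟨x, -, hx⟩
    exact hx ▸ x.2

theorem emb_notMem_exterior (c : ConnectedComponents X₁) {y : CoverCylinder (N.nbhd c).mult}
    (hy : height y < 1) : (N.nbhd c).emb y ∉ N.exterior := by
  have h : IsOpen ((N.nbhd c).emb '' {y | height y < 1}) :=
    (N.nbhd c).isOpen_image (isOpen_lt continuous_height continuous_const) fun y hy => ne_of_lt hy
  rw [exterior, closure_compl, Set.mem_compl_iff, not_not]
  exact interior_maximal ((Set.image_subset_range _ _).trans
    (Set.subset_iUnion (fun c => Set.range (N.nbhd c).emb) c)) h ⟨y, hy, rfl⟩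

theorem disjoint_exterior : Disjoint N.exterior X₁ := by
  refine Set.disjoint_right.mpr fun x hx => ?_
  obtain ⟨c, hc⟩ := exists_mem_componentSet hx
  obtain ⟨y, rfl⟩ := N.componentSet_subset_range c hc
  refine N.emb_notMem_exterior c ?_
  rw [(N.emb_mem_iff c y).mp hx]
  exact one_pos

/-- A point in a component of the exterior. -/
noncomputable def whitePoint (w : ConnectedComponents N.exterior) : X :=
  ((ConnectedComponents.surjective_coe w).choose : N.exterior)

theorem whitePoint_injective : Function.Injective N.whitePoint := by
  intro w w' h
  rw [← (ConnectedComponents.surjective_coe w).choose_spec,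
    ← (ConnectedComponents.surjective_coe w').choose_spec]
  exact congrArg _ (Subtype.ext h)

theorem exists_isPreconnected_whitePoint (x : N.exterior) :
    ∃ Z ⊆ N.exterior, IsPreconnected Z ∧ (x : X) ∈ Z ∧
      N.whitePoint (ConnectedComponents.mk x) ∈ Z := by
  refine ⟨Subtype.val '' connectedComponent x, Subtype.coe_image_subset _ _,
    isPreconnected_connectedComponent.image _ continuous_subtype_val.continuousOn,
    ⟨x, mem_connectedComponent, rfl⟩, ⟨_, ?_, rfl⟩⟩
  rw [← ConnectedComponents.coe_eq_coe']
  exact (ConnectedComponents.surjective_coe _).choose_spec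

end Basic

variable {X : Type u} [TopologicalSpace X] {X₁ : Set X} (N : RegularNbhdSystem X₁)

/-- If `H₁(X; ℤ/2) = 0`, then all edges of the graph are bridges. -/
theorem exists_bridge (hX : IsTwoStratifold X₁) (h : Subsingleton (H1ModTwo X))
    (e : (N.graph hX).Edge) :
    ∃ (fW : (N.graph hX).White → ZMod 2) (fB : (N.graph hX).Black → ZMod 2),
      fW ((N.graph hX).white e) + fB ((N.graph hX).black e) = 1 ∧
      ∀ e' ≠ e, fW ((N.graph hX).white e') + fB ((N.graph hX).black e') = 0 := by
  have := hX.hausdorff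
  have := hX.locallyPathConnectedSpace
  obtain ⟨c, i⟩ := e
  obtain ⟨g, hg, hg0, hgF⟩ := (N.nbhd c).exists_cut_of_sheet i
  obtain ⟨F, hF⟩ := exists_potAt_of_subsingleton_homology h hg
  -- The values of `F` on the exterior components and on the cores are the required vertex
  -- functions: `F` changes only across the middle circle of the sheet `i`.
  have hloc (x : X) (hx : x ∉ (N.nbhd c).emb '' {y | sheetHeight i y = 1 / 2}) :
      ∀ᶠ a in 𝓝 x, F a = F x := by
    simpa using (hg0 x hx).eventually_add_eq (hF x)
  have hwhite (e' : (N.graph hX).Edge) :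
      F (N.whitePoint ((N.graph hX).white e')) = F (N.basepoint e'.1 e'.2) := by
    obtain ⟨Z, hZ, hZc, h1, h2⟩ := N.exists_isPreconnected_whitePoint
      ⟨N.basepoint e'.1 e'.2, N.circle_subset_exterior hX e'.1 e'.2 (N.basepoint_mem e'.1 e'.2)⟩
    refine hZc.eq_of_eventually_eq (fun x hx => hloc x ?_) h2 h1
    rintro ⟨y, hy, rfl⟩
    refine N.emb_notMem_exterior c ?_ (hZ hx)
    have hy : sheetHeight i y = 1 / 2 := hy
    rcases eq_corePoint_or_eq_point y with ⟨z, rfl⟩ | ⟨j, z, t, rfl⟩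
    · exact one_pos
    · by_cases hij : j = i
      · subst hij
        rw [sheetHeight_point_self] at hy
        rw [height_point, hy]
        norm_num
      · rw [sheetHeight_point_of_ne hij] at hy
        norm_num at hy
  have hblack (c' : ConnectedComponents X₁) (j : Fin (N.nbhd c').r) :
      (N.nbhd c').emb (corePoint _ 1) = (N.nbhd c').emb (point _ j 1 0) := by
    rw [point_zero, one_pow]
  refine ⟨fun w => F (N.whitePoint w), fun c' => F ((N.nbhd c').emb (corePoint _ 1)), ?_, ?_⟩
  · change F (N.whitePoint ((N.graph hX).white ⟨c, i⟩)) + F ((N.nbhd c).emb (corePoint _ 1)) = 1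
    rw [hwhite ⟨c, i⟩, hblack c i, add_comm]
    exact hgF F hF
  · rintro ⟨c', j⟩ hne
    change F (N.whitePoint ((N.graph hX).white ⟨c', j⟩)) + F ((N.nbhd c').emb (corePoint _ 1)) = 0
    rw [hwhite ⟨c', j⟩, hblack c' j, zmod_two_add_eq_zero_iff]
    let γ : unitInterval → X := fun t => (N.nbhd c').emb (point _ j 1 t)
    have hγ : Continuous γ := (N.nbhd c').isEmbedding.continuous.comp
      ((continuous_point j).comp (Continuous.prodMk_right 1))
    refine (isPreconnected_range hγ).eq_of_eventually_eq (fun x hx => hloc x ?_) ⟨1, rfl⟩ ⟨0, rfl⟩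
    rintro ⟨y, hy, rfl⟩
    obtain ⟨t, ht⟩ := hx
    obtain rfl := N.eq_of_emb_mem_range ⟨_, ht⟩
    have hij : j ≠ i := fun h => hne (h ▸ rfl)
    rw [← (N.nbhd c).isEmbedding.injective ht] at hy
    have hy : sheetHeight i (point (N.nbhd c).mult j 1 t) = 1 / 2 := hy
    rw [sheetHeight_point_of_ne hij] at hy
    norm_num at hy

/-- The white vertex at the end of the `i`-th boundary circle of the regular neighborhood of `c`. -/
noncomputable def edgeWhite (hX : IsTwoStratifold X₁) (c : ConnectedComponents X₁)
    (i : Fin (N.nbhd c).r) : ConnectedComponents N.exterior :=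
  (N.graph hX).white ⟨c, i⟩

/-- The outer half of the sheet and the adjacent exterior component are connected, avoid `X₁`, and
share the base point of the boundary circle. -/
theorem linked_cutPoint_whitePoint (hX : IsTwoStratifold X₁) (c : ConnectedComponents X₁)
    (p : Σ i : Fin (N.nbhd c).r, rootsOfUnity ((N.nbhd c).mult i) Circle) :
    Linked X₁ ((N.nbhd c).cutPoint p) (N.whitePoint (N.edgeWhite hX c p.1)) := by
  have := hX.hausdorff
  have hpl : ∀ x ∉ X₁, PlanarAt x := fun x hx => hX.planarAt hx
  refine Linked.trans hpl (q := N.basepoint c p.1) ?_ ?_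
  · let k : Circle × unitInterval → X := fun q => (N.nbhd c).emb (point _ p.1 q.1 q.2)
    have hk : Continuous k := (N.nbhd c).isEmbedding.continuous.comp (continuous_point p.1)
    have : PreconnectedSpace Circle :=
      Circle.exp_surjective.denseRange.preconnectedSpace Circle.exp.continuous
    have hZ : IsPreconnected (k '' (Set.univ ×ˢ Set.Icc midpointUnitInterval 1)) :=
      (isPreconnected_univ.prod isPreconnected_Icc).image _ hk.continuousOn
    refine hZ.linked hX.isClosed hpl ?_
      ⟨((p.2 : Circleˣ), midpointUnitInterval), ⟨trivial, le_rfl, unitInterval.le_one'⟩, rfl⟩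
      ⟨(1, 1), ⟨trivial, unitInterval.le_one', le_rfl⟩, rfl⟩
    refine Set.disjoint_left.mpr ?_
    rintro _ ⟨⟨z, t⟩, ⟨-, ht, -⟩, rfl⟩ hx
    have h0 : (t : ℝ) = 0 := (N.emb_mem_iff c _).mp hx
    have h1 : (1 / 2 : ℝ) ≤ t := ht
    linarith
  · obtain ⟨Z, hZ, hZc, h1, h2⟩ := N.exists_isPreconnected_whitePoint
      ⟨N.basepoint c p.1, N.circle_subset_exterior hX c p.1 (N.basepoint_mem c p.1)⟩
    exact hZc.linked hX.isClosed hpl (N.disjoint_exterior.mono_left hZ) h1 h2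

/-- The cut across the core of a regular neighborhood, continued to the white vertices. -/
theorem exists_cut_to_whitePoint (hX : IsTwoStratifold X₁) (c : ConnectedComponents X₁) :
    ∃ g : X → X → ZMod 2, (∀ x, MildAt g x) ∧ (∀ x ∈ X₁, CocycleAt g x) ∧
      (∀ c' ≠ c, ∀ x ∈ componentSet c', PotAt g 0 x) ∧
      (∀ x ∉ X₁, singIndex g x = ∑ i : Fin (N.nbhd c).r, ((N.nbhd c).mult i : ZMod 2) *
        Set.indicator {N.whitePoint (N.edgeWhite hX c i)} 1 x) ∧
      ¬ ∃ F, ∀ x ∈ componentSet c, PotAt g F x := by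
  classical
  have := hX.hausdorff
  have hpl : ∀ x ∉ X₁, PlanarAt x := fun x hx => hX.planarAt hx
  have (i : Fin (N.nbhd c).r) := (N.nbhd c).finite_rootsOfUnity i
  obtain ⟨T, hT1, hT2, hT3, hT4⟩ := (N.nbhd c).exists_cut_across_core
  choose K hK1 hK2 hK3 using fun p => N.linked_cutPoint_whitePoint hX c p
  have (i : Fin (N.nbhd c).r) : Fintype (rootsOfUnity ((N.nbhd c).mult i) Circle) :=
    Fintype.ofFinite _
  have hcomp {c' : ConnectedComponents X₁} {x : X} (hx : x ∈ componentSet c') : x ∈ X₁ := by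
    obtain ⟨y, -, rfl⟩ := hx
    exact y.2
  have hKsum {x : X} (hx : x ∈ X₁) : PotAt (∑ p, K p) 0 x := by
    simpa using potAt_sum (f := fun _ => 0) Finset.univ fun p _ => hK1 p x hx
  have hTX : ∀ x ∈ X₁, CocycleAt T x := by
    intro x hx
    refine hT2 x ?_
    rintro ⟨p, rfl⟩
    have : (1 / 2 : ℝ) = 0 := (N.emb_mem_iff c _).mp hx
    norm_num at this
  have hTmild (x : X) : MildAt T x := mildAt_of_finite (Set.finite_range _) hT2 x
  have hKmild (x : X) : MildAt (∑ p, K p) x := mildAt_sum _ fun p _ => hK2 p x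
  -- Each `K p` cancels the end of `T` at `cutPoint p` and moves it to the white point. Sheet `i`
  -- has `mult i` ends, which is the coefficient in the index.
  refine ⟨T + ∑ p, K p, fun x => (hTmild x).add (hKmild x),
    fun x hx => (hTX x hx).add ⟨0, hKsum hx⟩, fun c' hc' x hx => ?_, fun x hx => ?_, ?_⟩
  · have hxr : x ∉ Set.range (N.nbhd c).emb := Set.disjoint_left.mp (N.disjoint hc')
      (N.componentSet_subset_range c' hx)
    simpa using (hT1 x hxr).add (hKsum (hcomp hx))
  · have hTi : singIndex T x = ∑ p, Set.indicator {(N.nbhd c).cutPoint p} 1 x := by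
      by_cases hxr : x ∈ Set.range (N.nbhd c).cutPoint
      · obtain ⟨p, rfl⟩ := hxr
        rw [Finset.sum_eq_single p ?_ (by simp)]
        · simp [singIndex, hT3 p]
        · intro q _ hq
          exact Set.indicator_of_notMem (s := {(N.nbhd c).cutPoint q})
            (fun h => hq ((N.nbhd c).cutPoint_injective h).symm) _
      · rw [singIndex_of_cocycleAt (hT2 x hxr)]
        refine (Finset.sum_eq_zero fun p _ => ?_).symm
        exact Set.indicator_of_notMem (s := {(N.nbhd c).cutPoint p})
          (fun h => hxr ⟨p, Eq.symm h⟩) _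
    rw [singIndex_add (hpl x hx) (hTmild x) (hKmild x),
      singIndex_sum (hpl x hx) _ fun p _ => hK2 p x, hTi, Finset.sum_congr rfl
        fun p _ => hK3 p x hx, Finset.sum_add_distrib, ← add_assoc, CharTwo.add_self_eq_zero,
      zero_add, Fintype.sum_sigma]
    refine Finset.sum_congr rfl fun i _ => ?_
    dsimp only
    rw [Finset.sum_const, Finset.card_univ, nsmul_eq_mul, ← Nat.card_eq_fintype_card,
      (N.nbhd c).natCard_rootsOfUnity]
  · rintro ⟨F, hF⟩
    refine hT4 ⟨F, fun x hx => ?_⟩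
    have := (hF x hx).add (hKsum (hcomp hx))
    rwa [add_assoc, cochain_add_self, add_zero, add_zero] at this

/-- A balanced weight on the black vertices yields a cocycle that is not a coboundary. -/
theorem weight_eq_zero (hX : IsTwoStratifold X₁) (h : Subsingleton (H1ModTwo X))
    [Fintype (ConnectedComponents X₁)] [DecidableEq (ConnectedComponents N.exterior)]
    (ε : ConnectedComponents X₁ → ZMod 2)
    (hε : ∀ w, ∑ c, ∑ i : Fin (N.nbhd c).r,
      (if N.edgeWhite hX c i = w then ((N.nbhd c).mult i : ZMod 2) else 0) * ε c = 0) : ε = 0 := by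
  classical
  have := hX.hausdorff
  have := hX.compact
  have := hX.locallyPathConnectedSpace
  have hpl : ∀ x ∉ X₁, PlanarAt x := fun x hx => hX.planarAt hx
  by_contra hne
  obtain ⟨c₀, hc₀⟩ := Function.ne_iff.mp hne
  have hone : ∀ a : ZMod 2, a ≠ 0 → a = 1 := by decide
  choose H hH1 hH2 hH3 hH4 hH5 using N.exists_cut_to_whitePoint hX
  let s : Finset (ConnectedComponents X₁) := {c | ε c ≠ 0}
  have hGmild (x : X) : MildAt (∑ c ∈ s, H c) x := mildAt_sum _ fun c _ => hH1 c x
  have hGX (x : X) (hx : x ∈ X₁) : CocycleAt (∑ c ∈ s, H c) x :=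
    cocycleAt_sum _ fun c _ => hH2 c x hx
  have hGrem (x : X) (hx : x ∉ X₁) : RemovableAt (∑ c ∈ s, H c) x := by
    rw [← singIndex_eq_zero_iff, singIndex_sum (hpl x hx) _ fun c _ => hH1 c x]
    have h1 : ∑ c ∈ s, singIndex (H c) x = ∑ c, ∑ i : Fin (N.nbhd c).r,
        ((N.nbhd c).mult i : ZMod 2) *
          Set.indicator {N.whitePoint (N.edgeWhite hX c i)} 1 x * ε c := by
      rw [Finset.sum_filter]
      refine Finset.sum_congr rfl fun c _ => ?_
      by_cases hc : ε c = 0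
      · simp [hc]
      · rw [if_pos hc, hH4 c x hx]
        simp only [hone _ hc, mul_one]
    rw [h1]
    -- At a white point the index is the balance sum of `ε` at that vertex; at all other points
    -- outside `X₁` no end remains.
    by_cases hxw : x ∈ Set.range N.whitePoint
    · obtain ⟨w, rfl⟩ := hxw
      rw [← hε w]
      refine Finset.sum_congr rfl fun c _ => Finset.sum_congr rfl fun i _ => ?_
      congr 1
      by_cases hw : N.edgeWhite hX c i = w
      · simp [hw]
      · have : N.whitePoint w ≠ N.whitePoint (N.edgeWhite hX c i) :=
          fun h => hw (N.whitePoint_injective h).symm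
        simp [hw, this]
    · refine Finset.sum_eq_zero fun c _ => Finset.sum_eq_zero fun i _ => ?_
      have : x ≠ N.whitePoint (N.edgeWhite hX c i) := fun h => hxw ⟨_, h.symm⟩
      simp [this]
  obtain ⟨g, hg, hgp⟩ := exists_cocycleAt_of_finite (finite_not_cocycleAt hGmild)
    (∑ c ∈ s, H c) (fun x hx => hGrem x fun hx' => hx (hGX x hx')) fun x hx => not_not.mp hx
  obtain ⟨F, hF⟩ := exists_potAt_of_subsingleton_homology h hg
  refine hH5 c₀ ⟨F, fun x hx => ?_⟩
  have hxX : x ∈ X₁ := by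
    obtain ⟨y, -, rfl⟩ := hx
    exact y.2
  obtain ⟨f, hf⟩ := hH2 c₀ x hxX
  have h1 : PotAt (∑ c ∈ s, H c) f x := by
    -- The other cuts vanish near the core of `c₀`, so there `F` would be a potential of `H c₀`
    -- alone, which is impossible.
    rw [← Finset.add_sum_erase s H (a := c₀) (by simpa [s] using hc₀)]
    have := potAt_sum (g := H) (f := fun _ => 0) (s.erase c₀)
      fun c hc => hH3 c c₀ (Finset.ne_of_mem_erase hc).symm x hx
    simpa using hf.add this
  exact hf.of_eventually_add_eq
    ((hgp x (fun hn => hn (hGX x hxX)) f h1).eventually_add_eq (hF x))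

end RegularNbhdSystem

/-! ### Labels when all terminal edges have label 2 -/

namespace BicoloredGraph

variable {G : BicoloredGraph.{u}}

/-- The label 3 occurs only at a black vertex of degree one, whose edge is terminal and so has label
2 by hypothesis. -/
theorem IsTrivalent.label_eq (hG : G.IsTrivalent)
    (hT : ∀ e : G.Edge, G.IsTerminal e → G.label e = 2) (e : G.Edge) :
    G.label e = 1 ∨ G.label e = 2 := by
  have hmem : e ∈ {e' | G.black e' = G.black e} := rfl
  rcases hG (G.black e) with ⟨e₁, e₂, e₃, -, -, -, hs, h1, h2, h3⟩ | ⟨e₁, e₂, -, hs, h1, h2⟩ |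
    ⟨e₁, hs, -⟩
  · rw [hs] at hmem
    rcases hmem with rfl | rfl | rfl
    exacts [.inl h1, .inl h2, .inl h3]
  · rw [hs] at hmem
    rcases hmem with rfl | rfl
    exacts [.inl h1, .inr h2]
  · refine .inr (hT e (.inr ⟨e, rfl, fun e' he' => ?_⟩))
    have he' : e' ∈ {e' | G.black e' = G.black e} := he'
    rw [hs] at hmem he'
    exact he'.trans hmem.symm

theorem exists_ne_of_not_terminal (hT : ∀ e : G.Edge, G.IsTerminal e → G.label e = 2) {e : G.Edge}
    (he : G.label e = 1) : ∃ e' ≠ e, G.white e' = G.white e := by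
  by_contra! h
  have := hT e (.inl ⟨e, rfl, fun e' he' => by_contra fun hne => h e' hne he'⟩)
  omega

end BicoloredGraph

theorem mainTheorem5 {X : Type u} [TopologicalSpace X] {X₁ : Set X} (hX : IsTwoStratifold X₁)
    (N : RegularNbhdSystem X₁) (hG : (N.graph hX).IsTrivalent)
    (hE : Nonempty (N.graph hX).Edge)
    (hT : ∀ e : (N.graph hX).Edge, (N.graph hX).IsTerminal e → (N.graph hX).label e = 2) :
    Nontrivial (H1ModTwo X) := by
  classical
  by_contra hn
  have hsub : Subsingleton (H1ModTwo X) := not_nontrivial_iff_subsingleton.mp hn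
  have hfin := hX.finite_components
  have : Fintype (ConnectedComponents X₁) := Fintype.ofFinite _
  have : Finite (N.graph hX).Black := hfin
  have : Nonempty (N.graph hX).Black := hE.map (N.graph hX).black
  let : Fintype (N.graph hX).Edge :=
    inferInstanceAs (Fintype (Σ c : ConnectedComponents X₁, Fin (N.nbhd c).r))
  obtain ⟨ε, hε0, hε⟩ := exists_balanced_weight (N.graph hX).white (N.graph hX).black
    (N.graph hX).label (hG.label_eq hT) (N.exists_bridge hX hsub)
    fun e he => BicoloredGraph.exists_ne_of_not_terminal hT he
  refine hε0 (N.weight_eq_zero hX hsub ε fun w => ?_)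
  refine Eq.trans ?_ (hε w)
  exact (Fintype.sum_sigma (ι := ConnectedComponents X₁) (α := fun c => Fin (N.nbhd c).r)
    (fun e => (if N.edgeWhite hX e.1 e.2 = w then ((N.nbhd e.1).mult e.2 : ZMod 2) else 0) *
      ε e.1)).symm
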